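/- Let $2\le\ell\le n-2$ and let $g\colon L^{n-\ell}\to\mathbb{S}^{n+1}\subset\mathbb{R}^{n+2}$ be a smooth isometric immersion of a Riemannian manifold into the unit sphere, with normal bundle $N_gL$ (in $\mathbb{S}^{n+1}$), second fundamental form $\alpha_g$ and shape operators $A^g_w$, $\langle A^g_wY,Z\rangle=\langle\alpha_g(Y,Z),w\rangle$. Let $\Lambda=\{(x,w)\in N_gL\colon\|w\|=1\}$ be its unit normal bundle, an $n$-dimensional manifold, let $\Pi\colon\Lambda\to L$, $\Pi(x,w)=x$, and let $\mathcal V=\ker\Pi_*$ be the vertical distribution. Let $\tau\in C^\infty(L)$ satisfy $0<\tau<\pi/2$ and $\|\nabla\tau\|<1$ everywhere, and let $\Psi\colon\Lambda\to\mathbb{S}^{n+1}$ be the smooth map $$\Psi(x,w)=\exp_{g(x)}\Big(-\tau(x)\big(g_*\nabla\tau(x)+\sqrt{1-\|\nabla\tau(x)\|^2}\,w\big)\Big),$$ where $\exp$ is the exponential map of $\mathbb{S}^{n+1}$. Let $M\subset\Lambda$ be the set of points at which $\Psi$ is regular, that is, has injective differential. Then: (i) For every $(x,w)\in\Lambda$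 the endomorphism of $T_xL$ given by $$P(x,w)Y=\cos\tau(x)\big(Y-\langle Y,\nabla\tau(x)\rangle\nabla\tau(x)\big)-\sin\tau(x)\,\mathrm{Hess}\,\tau(x)Y+\sin\tau(x)\sqrt{1-\|\nabla\tau(x)\|^2}\,A^g_wY$$ is self-adjoint, and $(x,w)\in M$ if and only if $P(x,w)$ is nonsingular. (ii) The Gauss map $\eta\colon M\to\mathbb{S}^{n+1}\subset\mathbb{R}^{n+2}$ of $\Psi$, which is unique up to sign at each point, is given by $$\eta(x,w)=\sin\tau(x)\,g(x)+\cos\tau(x)\big(g_*\nabla\tau(x)+\sqrt{1-\|\nabla\tau(x)\|^2}\,w\big).$$ That is, $\eta$ is smooth and, at each $p\in M$, the unit vectors tangent to $\mathbb{S}^{n+1}$ at $\Psi(p)$ and normal to $\Psi_*(T_pM)$ are exactly $\pm\eta(p)$. (iii) At each $p=(x,w)\in M$ the shape operator $A$ of $\Psi|_M$ with respect to $\eta$, that is, the unique endomorphism of $T_pM$ with $\eta_*V=-\Psi_*(AV)$ for all $V\in T_pM$, has $\cot\tau(x)$ as a principal curvature, and the corresponding eigenspace is exactly $\mathcal V(p)$.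 -/

import Mathlib

open scoped Manifold ContDiff Topology InnerProductSpace RealInnerProductSpace

noncomputable section

namespace SphereTube

/-- The Riesz isomorphism of a finite-dimensional Euclidean space: `riesz F φ` is the vector with
`⟪riesz F φ, v⟫ = φ v` for all `v`. -/
def riesz (F : Type*) [NormedAddCommGroup F] [InnerProductSpace ℝ F] [FiniteDimensional ℝ F] :
    (F →ₗ[ℝ] ℝ) →ₗ[ℝ] F where
  toFun φ := (InnerProductSpace.toDual ℝ F).symm (LinearMap.toContinuousLinearMap φ)
  map_add' φ ψ := by simp
  map_smul' c φ := by simp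

theorem inner_riesz {F : Type*} [NormedAddCommGroup F] [InnerProductSpace ℝ F]
    [FiniteDimensional ℝ F] (φ : F →ₗ[ℝ] ℝ) (v : F) : ⟪riesz F φ, v⟫ = φ v := by
  simp [riesz]

section Trilinear

variable {F : Type*} [NormedAddCommGroup F] [NormedSpace ℝ F] (T : F →L[ℝ] F →L[ℝ] F →L[ℝ] ℝ)

theorem trilinear_add₁ (a a' b c : F) : T (a + a') b c = T a b c + T a' b c := by simp

theorem trilinear_add₂ (a b b' c : F) : T a (b + b') c = T a b c + T a b' c := by simp

theorem trilinear_smul₁ (r : ℝ) (a b c : F) : T (r • a) b c = r * T a b c := by simp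

theorem trilinear_smul₂ (r : ℝ) (a b c : F) : T a (r • b) c = r * T a b c := by simp

end Trilinear

section Riemannian

/-! ### Gradient, Levi-Civita connection and Hessian on a Riemannian manifold -/

variable {m : ℕ} {L : Type*} [TopologicalSpace L] [ChartedSpace (EuclideanSpace ℝ (Fin m)) L]

instance finiteDimensional_tangentSpace (x : L) :
    FiniteDimensional ℝ (TangentSpace (𝓡 m) x) :=
  inferInstanceAs (FiniteDimensional ℝ (EuclideanSpace ℝ (Fin m)))

variable [Bundle.RiemannianBundle (fun x : L => TangentSpace (𝓡 m) x)]

/-! The inner products on the tangent spaces given by the Riemannian metric. -/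

instance normedAddCommGroup_tangentSpace (x : L) : NormedAddCommGroup (TangentSpace (𝓡 m) x) :=
  Bundle.instNormedAddCommGroupOfRiemannianBundleOfIsTopologicalAddGroupOfContinuousConstSMulReal
    (E := fun x : L => TangentSpace (𝓡 m) x) x

instance innerProductSpace_tangentSpace (x : L) : InnerProductSpace ℝ (TangentSpace (𝓡 m) x) :=
  Bundle.instInnerProductSpaceReal (E := fun x : L => TangentSpace (𝓡 m) x) x

/-- The gradient of a function on a Riemannian manifold. -/
def grad (τ : L → ℝ) (x : L) : TangentSpace (𝓡 m) x :=
  riesz (TangentSpace (𝓡 m) x) (mvfderiv (𝓡 m) τ x : TangentSpace (𝓡 m) x →ₗ[ℝ] ℝ)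

/-- The Riemannian metric in the preferred chart around `x`: the inner product of the coordinate
vectors with components `a` and `b` at the point with coordinates `u`. -/
def chartMetric (x : L) (u : EuclideanSpace ℝ (Fin m)) :
    EuclideanSpace ℝ (Fin m) →L[ℝ] EuclideanSpace ℝ (Fin m) →L[ℝ] ℝ :=
  let D : EuclideanSpace ℝ (Fin m) →L[ℝ] TangentSpace (𝓡 m) ((extChartAt (𝓡 m) x).symm u) :=
    mfderiv 𝓘(ℝ, EuclideanSpace ℝ (Fin m)) (𝓡 m) (extChartAt (𝓡 m) x).symm u
  (innerSL ℝ (E := TangentSpace (𝓡 m) ((extChartAt (𝓡 m) x).symm u))).bilinearComp D D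

/-- The derivative of the metric at `x` in the preferred chart around `x`: `dMetric x a b c` is
`∂_a ⟨b, c⟩`. The tangent space at `x` is identified with the model space by that chart. -/
def dMetric (x : L) (a b c : TangentSpace (𝓡 m) x) : ℝ :=
  fderiv ℝ (chartMetric x) (extChartAt (𝓡 m) x x) a b c

theorem dMetric_add₁ (x : L) (a a' b c : TangentSpace (𝓡 m) x) :
    dMetric x (a + a') b c = dMetric x a b c + dMetric x a' b c :=
  trilinear_add₁ (fderiv ℝ (chartMetric x) (extChartAt (𝓡 m) x x)) a a' b c

theorem dMetric_add₂ (x : L) (a b b' c : TangentSpace (𝓡 m) x) :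
    dMetric x a (b + b') c = dMetric x a b c + dMetric x a b' c :=
  trilinear_add₂ (fderiv ℝ (chartMetric x) (extChartAt (𝓡 m) x x)) a b b' c

theorem dMetric_add₃ (x : L) (a b c c' : TangentSpace (𝓡 m) x) :
    dMetric x a b (c + c') = dMetric x a b c + dMetric x a b c' :=
  map_add (fderiv ℝ (chartMetric x) (extChartAt (𝓡 m) x x) a b) c c'

theorem dMetric_smul₁ (x : L) (r : ℝ) (a b c : TangentSpace (𝓡 m) x) :
    dMetric x (r • a) b c = r * dMetric x a b c :=
  trilinear_smul₁ (fderiv ℝ (chartMetric x) (extChartAt (𝓡 m) x x)) r a b c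

theorem dMetric_smul₂ (x : L) (r : ℝ) (a b c : TangentSpace (𝓡 m) x) :
    dMetric x a (r • b) c = r * dMetric x a b c :=
  trilinear_smul₂ (fderiv ℝ (chartMetric x) (extChartAt (𝓡 m) x x)) r a b c

theorem dMetric_smul₃ (x : L) (r : ℝ) (a b c : TangentSpace (𝓡 m) x) :
    dMetric x a b (r • c) = r * dMetric x a b c :=
  map_smul (fderiv ℝ (chartMetric x) (extChartAt (𝓡 m) x x) a b) r c

/-- The linear form `c ↦ (∂_a ⟨b, c⟩ + ∂_b ⟨a, c⟩ - ∂_c ⟨a, b⟩) / 2`. -/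
def koszulForm (x : L) (a b : TangentSpace (𝓡 m) x) : TangentSpace (𝓡 m) x →ₗ[ℝ] ℝ where
  toFun c := (dMetric x a b c + dMetric x b a c - dMetric x c a b) / 2
  map_add' c c' := by simp only [dMetric_add₁, dMetric_add₃]; ring
  map_smul' r c := by
    simp only [dMetric_smul₁, dMetric_smul₃, RingHom.id_apply, smul_eq_mul]; ring

/-- The Christoffel symbols at `x` of the preferred chart around `x`, as a bilinear map:
`2 ⟨Γ(a, b), c⟩ = ∂_a ⟨b, c⟩ + ∂_b ⟨a, c⟩ - ∂_c ⟨a, b⟩`. -/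
def christoffel (x : L) :
    TangentSpace (𝓡 m) x →ₗ[ℝ] TangentSpace (𝓡 m) x →ₗ[ℝ] TangentSpace (𝓡 m) x :=
  LinearMap.mk₂ ℝ (fun a b => riesz (TangentSpace (𝓡 m) x) (koszulForm x a b))
    (fun a a' b => by
      rw [← map_add]; congr 1; ext c
      simp only [koszulForm, LinearMap.coe_mk, AddHom.coe_mk, LinearMap.add_apply,
        dMetric_add₁, dMetric_add₂]; ring)
    (fun r a b => by
      rw [← map_smul]; congr 1; ext c
      simp only [koszulForm, LinearMap.coe_mk, AddHom.coe_mk, LinearMap.smul_apply,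
        dMetric_smul₁, dMetric_smul₂, smul_eq_mul]; ring)
    (fun a b b' => by
      rw [← map_add]; congr 1; ext c
      simp only [koszulForm, LinearMap.coe_mk, AddHom.coe_mk, LinearMap.add_apply,
        dMetric_add₁, dMetric_add₂, dMetric_add₃]; ring)
    (fun r a b => by
      rw [← map_smul]; congr 1; ext c
      simp only [koszulForm, LinearMap.coe_mk, AddHom.coe_mk, LinearMap.smul_apply,
        dMetric_smul₁, dMetric_smul₂, dMetric_smul₃, smul_eq_mul]; ring)

/-- The components of the vector field `X` in the preferred chart around `x`, as a function of the
point. -/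
def chartComponents (x : L) (X : (y : L) → TangentSpace (𝓡 m) y) (y : L) :
    EuclideanSpace ℝ (Fin m) :=
  mvfderiv (𝓡 m) (extChartAt (𝓡 m) x) y (X y)

/-- The Levi-Civita covariant derivative `Y ↦ ∇_Y X` of the vector field `X` at `x`, in the
preferred chart around `x`: `∇_Y X = Y(Xᵏ) ∂_k + Γ(Y, X)`. -/
def covDeriv (X : (y : L) → TangentSpace (𝓡 m) y) (x : L) :
    TangentSpace (𝓡 m) x →ₗ[ℝ] TangentSpace (𝓡 m) x :=
  let dX : TangentSpace (𝓡 m) x →ₗ[ℝ] EuclideanSpace ℝ (Fin m) :=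
    (mvfderiv (𝓡 m) (chartComponents x X) x : TangentSpace (𝓡 m) x →ₗ[ℝ] _)
  (show TangentSpace (𝓡 m) x →ₗ[ℝ] TangentSpace (𝓡 m) x from dX) +
    (christoffel x).flip (X x)

/-- The Hessian of `τ` as an endomorphism of the tangent space: `Hess τ (Y) = ∇_Y ∇τ`. -/
def hess (τ : L → ℝ) (x : L) : TangentSpace (𝓡 m) x →ₗ[ℝ] TangentSpace (𝓡 m) x :=
  covDeriv (grad τ) x

end Riemannian

section Submanifold

/-! ### Submanifolds of the unit sphere

`g : L → 𝕊` is a map into the unit sphere of a Euclidean space `E`. -/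

variable {m : ℕ} {L : Type*} [TopologicalSpace L] [ChartedSpace (EuclideanSpace ℝ (Fin m)) L]
  {E : Type*} [NormedAddCommGroup E] [InnerProductSpace ℝ E] [FiniteDimensional ℝ E]

/-- The differential `g_*` of `g`, with values in the ambient Euclidean space. -/
def dMap (g : L → Metric.sphere (0 : E) 1) (x : L) : TangentSpace (𝓡 m) x →L[ℝ] E :=
  mvfderiv (𝓡 m) (fun y => (g y : E)) x

/-- The normal space `N_g L (x)` of `g` in the sphere: the vectors tangent to the sphere at `g x`
and orthogonal to `g_* T_x L`. -/
def normalSpace (m : ℕ) [ChartedSpace (EuclideanSpace ℝ (Fin m)) L] (g : L → Metric.sphere (0 : E) 1) (x : L) : Submodule ℝ E :=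
  (Submodule.span ℝ {(g x : E)} ⊔ LinearMap.range (dMap (m := m) g x).toLinearMap)ᗮ

/-- The unit normal bundle `Λ` of `g`. -/
def unitNormalBundle (m : ℕ) [ChartedSpace (EuclideanSpace ℝ (Fin m)) L]
    (g : L → Metric.sphere (0 : E) 1) : Set (L × E) :=
  {p | p.2 ∈ normalSpace m g p.1 ∧ ‖p.2‖ = 1}

/-- The second derivative of `g` at `x` in the preferred chart around `x`: the derivative in the
direction `Y` of `g_* Z`, where `Z` is extended with constant components in that chart. -/
def secondDeriv (g : L → Metric.sphere (0 : E) 1) (x : L) (Y Z : TangentSpace (𝓡 m) x) : E :=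
  fderiv ℝ (fderiv ℝ (fun u => (g ((extChartAt (𝓡 m) x).symm u) : E)))
    (extChartAt (𝓡 m) x x) Y Z

/-- The second fundamental form `α_g` of `g`: `α_g(Y, Z)` is the component in the normal space of
the derivative in the direction `Y` of `g_* Z`, for any local extension of `Z`. -/
def secondFundamentalForm (g : L → Metric.sphere (0 : E) 1) (x : L) :
    TangentSpace (𝓡 m) x →ₗ[ℝ] TangentSpace (𝓡 m) x →ₗ[ℝ] E :=
  LinearMap.mk₂ ℝ (fun Y Z => (normalSpace m g x).starProjection (secondDeriv g x Y Z))
    (fun Y Y' Z => by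
      rw [← map_add]; congr 1; unfold secondDeriv; erw [map_add]; rfl)
    (fun r Y Z => by
      rw [← map_smul]; congr 1; unfold secondDeriv; erw [map_smul]; rfl)
    (fun Y Z Z' => by
      rw [← map_add]; congr 1; unfold secondDeriv; erw [map_add])
    (fun r Y Z => by
      rw [← map_smul]; congr 1; unfold secondDeriv; erw [map_smul])

variable [Bundle.RiemannianBundle (fun x : L => TangentSpace (𝓡 m) x)]

/-- The shape operator `A^g_w` of `g`: `⟨A^g_w Y, Z⟩ = ⟨α_g(Y, Z), w⟩`. -/
def shapeOp (g : L → Metric.sphere (0 : E) 1) (x : L) (w : E) :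
    TangentSpace (𝓡 m) x →ₗ[ℝ] TangentSpace (𝓡 m) x :=
  riesz (TangentSpace (𝓡 m) x) ∘ₗ (secondFundamentalForm g x).compr₂ (innerSL ℝ w).toLinearMap

/-- The exponential map of the unit sphere at `p`:
`exp_p v = cos ‖v‖ p + sin ‖v‖ v / ‖v‖` for `v` orthogonal to `p`. -/
def sphereExp (p v : E) : E := Real.cos ‖v‖ • p + Real.sinc ‖v‖ • v

/-- The unit vector `g_* ∇τ + √(1 - ‖∇τ‖²) w`. -/
def tubeDirection (m : ℕ) [ChartedSpace (EuclideanSpace ℝ (Fin m)) L]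
    [Bundle.RiemannianBundle (fun x : L => TangentSpace (𝓡 m) x)]
    (g : L → Metric.sphere (0 : E) 1) (τ : L → ℝ) (p : L × E) : E :=
  dMap g p.1 (grad (m := m) τ p.1) + √(1 - ‖grad (m := m) τ p.1‖ ^ 2) • p.2

/-- The map `Ψ(x, w) = exp_{g(x)} (-τ(x) (g_* ∇τ(x) + √(1 - ‖∇τ(x)‖²) w))`. The formula makes
sense on all of `L × E`; only its restriction to `unitNormalBundle g` matters. -/
def tubeMap (m : ℕ) [ChartedSpace (EuclideanSpace ℝ (Fin m)) L]
    [Bundle.RiemannianBundle (fun x : L => TangentSpace (𝓡 m) x)]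
    (g : L → Metric.sphere (0 : E) 1) (τ : L → ℝ) (p : L × E) : E :=
  sphereExp (g p.1) (-(τ p.1) • tubeDirection m g τ p)

/-- The map `η(x, w) = sin τ(x) g(x) + cos τ(x) (g_* ∇τ(x) + √(1 - ‖∇τ(x)‖²) w)`. -/
def tubeNormal (m : ℕ) [ChartedSpace (EuclideanSpace ℝ (Fin m)) L]
    [Bundle.RiemannianBundle (fun x : L => TangentSpace (𝓡 m) x)]
    (g : L → Metric.sphere (0 : E) 1) (τ : L → ℝ) (p : L × E) : E :=
  Real.sin (τ p.1) • (g p.1 : E) + Real.cos (τ p.1) • tubeDirection m g τ p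

/-- The endomorphism `P(x, w)` of `T_x L`. -/
def tubeP (g : L → Metric.sphere (0 : E) 1) (τ : L → ℝ) (x : L) (w : E) :
    TangentSpace (𝓡 m) x →ₗ[ℝ] TangentSpace (𝓡 m) x :=
  Real.cos (τ x) •
      (LinearMap.id - (innerSL ℝ (grad (m := m) τ x)).toLinearMap.smulRight (grad τ x)) -
    Real.sin (τ x) • hess τ x +
    (Real.sin (τ x) * √(1 - ‖grad (m := m) τ x‖ ^ 2)) • shapeOp g x w

end Submanifold

section TangentSpaces

/-! ### Tangent spaces of subsets of `L × E`, immersions, Gauss maps, shape operators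

`Λ` is an embedded submanifold of `L × E`. Smooth maps on `Λ` are given as restrictions of maps
that are smooth on a neighbourhood in `L × E`; their differentials are the restrictions of the
ambient differentials to the tangent spaces of `Λ`. -/

variable {m : ℕ} {L : Type*} [TopologicalSpace L] [ChartedSpace (EuclideanSpace ℝ (Fin m)) L]
  {E : Type*} [NormedAddCommGroup E] [InnerProductSpace ℝ E] [FiniteDimensional ℝ E]

/-- The velocity vectors at `p` of the smooth curves in `S` through `p`. -/
def velocities (S : Set (L × E)) (p : L × E) : Set (TangentSpace ((𝓡 m).prod 𝓘(ℝ, E)) p) :=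
  {V | ∃ c : ℝ → L × E, ContMDiffAt 𝓘(ℝ, ℝ) ((𝓡 m).prod 𝓘(ℝ, E)) ∞ c 0 ∧
    (∀ᶠ t in 𝓝 (0 : ℝ), c t ∈ S) ∧
    ∃ h : c 0 = p, V = h ▸ mfderiv 𝓘(ℝ, ℝ) ((𝓡 m).prod 𝓘(ℝ, E)) c 0 (1 : ℝ)}

/-- The tangent space `T_p S`: the linear space of the velocity vectors at `p` of the smooth curves
in `S`. For an embedded submanifold these vectors already form a linear space. -/
def tangentTo (S : Set (L × E)) (p : L × E) :
    Submodule ℝ (TangentSpace ((𝓡 m).prod 𝓘(ℝ, E)) p) :=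
  Submodule.span ℝ (velocities S p)

/-- The differential `F_*(p) : T_p S → E` of the restriction to `S` of a map `F`. -/
def diffOn (S : Set (L × E)) (F : L × E → E) (p : L × E) : tangentTo (m := m) S p →ₗ[ℝ] E :=
  (mvfderiv ((𝓡 m).prod 𝓘(ℝ, E)) F p).toLinearMap ∘ₗ (tangentTo S p).subtype

/-- The points of `S` at which the restriction of `F` to `S` is regular, that is, has injective
differential. -/
def regularSet (m : ℕ) [ChartedSpace (EuclideanSpace ℝ (Fin m)) L] (S : Set (L × E))
    (F : L × E → E) : Set (L × E) :=
  {p | p ∈ S ∧ Function.Injective (diffOn (m := m) S F p)}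

/-- The vertical space at `p`: the kernel of the differential at `p` of the projection
`S → L`, `(x, w) ↦ x`. -/
def verticalSpace (S : Set (L × E)) (p : L × E) : Submodule ℝ (tangentTo (m := m) S p) :=
  LinearMap.ker ((mfderiv ((𝓡 m).prod 𝓘(ℝ, E)) (𝓡 m) (Prod.fst : L × E → L) p).toLinearMap ∘ₗ
    (tangentTo S p).subtype)

/-- `ν` is a unit vector tangent to the unit sphere at `F p` and normal to the hypersurface
`F : S → 𝕊` at `p`. -/
def IsUnitNormalAt (m : ℕ) [ChartedSpace (EuclideanSpace ℝ (Fin m)) L] (S : Set (L × E))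
    (F : L × E → E) (p : L × E) (ν : E) : Prop :=
  ‖ν‖ = 1 ∧ ⟪ν, F p⟫ = 0 ∧ ∀ V : tangentTo (m := m) S p, ⟪ν, diffOn S F p V⟫ = 0

/-- `A` is the shape operator at `p` of the hypersurface `F : S → 𝕊` with Gauss map `η`:
`η_* V = -F_* (A V)`. -/
def IsShapeOperatorAt (S : Set (L × E)) (F η : L × E → E) (p : L × E)
    (A : tangentTo (m := m) S p →ₗ[ℝ] tangentTo (m := m) S p) : Prop :=
  ∀ V, diffOn S η p V = -diffOn S F p (A V)

end TangentSpaces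

end SphereTube

end

open SphereTube

/-! Put ρ = √(1 - ‖∇τ‖²) and N = g_*∇τ + ρ w. On Λ the vector N is a unit vector orthogonal to g, so
Ψ = cos τ g - sin τ N and η = sin τ g + cos τ N form an orthonormal pair, obtained from (g, N) by a
rotation. For V tangent to Λ and projecting to Y, Ψ_*V = -dτ(Y) η + cos τ g_*Y - sin τ N_*V, η_*V =
dτ(Y) Ψ + sin τ g_*Y + cos τ N_*V. The gradient term in N is there to give ⟨N, g_*Z⟩ = dτ(Z).
Differentiating this together with ⟨g, N⟩ = 0 and ‖N‖ = 1 yields ⟨g, N_*V⟩ = -dτ(Y), ⟨N, N_*V⟩ = 0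
and ⟨g_*Z, N_*V⟩ = ⟨Z, Hess τ Y⟩ - ρ⟨Z, A_w Y⟩ (`inner_dMap_dDirection`). Consequently η is
orthogonal to Ψ_*V, and ⟨g_*Z, Ψ_*V⟩ = ⟨Z, P Y⟩.

On vertical vectors Ψ_* is -ρ sin τ times the fibre component, so it maps the vertical space
isomorphically onto the complement of g, w and g_*TL; whether Ψ_* is injective is therefore decided
by P (`TubeData.injective_dF_iff`). Eliminating N_* gives sin τ η_*V + cos τ Ψ_*V = g_*Y - dτ(Y) N.
If this vanishes then ‖Y‖ = |dτ(Y)|, and ‖∇τ‖ < 1 forces Y = 0: the eigenvectors for cot τ are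
exactly the vertical ones (`TubeData.dη_eq_iff`).

The tangent space of Λ is spanned by velocities of curves, so identities on Λ are differentiated
along curves in it (`eqOn_tangentTo`); great circles in the fibres and local unit normal sections
supply enough curves. Since g is isometric, the metric in a chart is the Gram form of dg, which
expresses the Levi-Civita Hessian through ambient second derivatives (`inner_hess`). `TubeData`
collects the resulting pointwise identities, and the three assertions become linear algebra. -/

noncomputable section
namespace SphereTube

/-! ### Gram forms of injective linear maps -/

section Gram

variable {F E : Type*} [NormedAddCommGroup F] [NormedSpace ℝ F]
  [NormedAddCommGroup E] [InnerProductSpace ℝ E]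

/-- The pullback of the inner product under a linear map. -/
def gram (B : F →L[ℝ] E) : F →L[ℝ] F →L[ℝ] ℝ :=
  ((ContinuousLinearMap.compL ℝ F E ℝ).flip B).comp ((innerSL ℝ (E := E)).comp B)

@[simp] theorem gram_apply (B : F →L[ℝ] E) (a b : F) : gram B a b = ⟪B a, B b⟫ := by
  simp [gram]

theorem contDiff_gram : ContDiff ℝ ∞ (gram (F := F) (E := E)) := by
  unfold gram; fun_prop

theorem gram_isInvertible [FiniteDimensional ℝ F] {B : F →L[ℝ] E} (hB : Function.Injective B) :
    (gram B).IsInvertible := by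
  have hinj : Function.Injective (gram B).toLinearMap := by
    rw [← LinearMap.ker_eq_bot, LinearMap.ker_eq_bot']
    intro a ha
    have h : gram B a a = 0 := by
      have : gram B a = 0 := ha
      rw [this]; rfl
    rw [gram_apply, inner_self_eq_zero] at h
    exact hB (h.trans (map_zero B).symm)
  have hdim : Module.finrank ℝ F = Module.finrank ℝ (F →L[ℝ] ℝ) := by
    rw [(LinearMap.toContinuousLinearMap (𝕜 := ℝ) (E := F) (F' := ℝ)).symm.finrank_eq]
    exact (Subspace.dual_finrank_eq (K := ℝ) (V := F)).symm
  let e := LinearEquiv.ofInjectiveOfFinrankEq _ hinj hdim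
  refine ⟨e.toContinuousLinearEquiv, ?_⟩
  ext a b
  rfl

/-- These are the normal equations. With θ = dτ the solution is the gradient in coordinates; with θ
= ⟨w, B ·⟩ its image under B is the orthogonal projection of w to the range of B. -/
theorem inner_gram_inverse [FiniteDimensional ℝ F] {B : F →L[ℝ] E} (hB : Function.Injective B)
    (θ : F →L[ℝ] ℝ) (c : F) : ⟪B ((gram B).inverse θ), B c⟫ = θ c := by
  rw [← gram_apply, (gram_isInvertible hB).self_apply_inverse]

theorem eq_gram_inverse [FiniteDimensional ℝ F] {B : F →L[ℝ] E} (hB : Function.Injective B)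
    {θ : F →L[ℝ] ℝ} {a : F} (h : ∀ c, ⟪B a, B c⟫ = θ c) : a = (gram B).inverse θ := by
  have : gram B a = θ := by ext c; rw [gram_apply, h]
  rw [← this, (gram_isInvertible hB).inverse_apply_self]

/-- Inversion of continuous linear maps is smooth at an invertible one, so the solution of the
normal equations varies smoothly. -/
theorem contDiffAt_gram_inverse [FiniteDimensional ℝ F] {H : Type*} [NormedAddCommGroup H]
    [NormedSpace ℝ H] {B : H → F →L[ℝ] E} {θ : H → F →L[ℝ] ℝ} {u : H}
    (hB : ContDiffAt ℝ ∞ B u) (hθ : ContDiffAt ℝ ∞ θ u) (hinj : Function.Injective (B u)) :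
    ContDiffAt ℝ ∞ (fun v => (gram (B v)).inverse (θ v)) u := by
  have : CompleteSpace F := FiniteDimensional.complete ℝ F
  have h1 : ContDiffAt ℝ ∞ (fun v => gram (B v)) u := contDiff_gram.contDiffAt.comp u hB
  have h2 : ContDiffAt ℝ ∞ (fun v => (gram (B v)).inverse) u :=
    ContDiffAt.comp (g := ContinuousLinearMap.inverse) u
      (gram_isInvertible hinj).contDiffAt_map_inverse h1
  exact h2.clm_apply hθ

end Gram

/-! ### Differentials in the preferred chart -/

section Chart

variable {m : ℕ} {L : Type*} [TopologicalSpace L] [ChartedSpace (EuclideanSpace ℝ (Fin m)) L]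
  {F : Type*} [NormedAddCommGroup F] [NormedSpace ℝ F]

/-- The differential at `x` of a function is the derivative of its expression in the preferred
chart around `x`. -/
theorem mvfderiv_eq_fderiv_chart {f : L → F} (x : L)
    (hf : MDifferentiableAt (𝓡 m) 𝓘(ℝ, F) f x) (Y : TangentSpace (𝓡 m) x) :
    mvfderiv (𝓡 m) f x Y =
      fderiv ℝ (fun u => f ((extChartAt (𝓡 m) x).symm u)) (extChartAt (𝓡 m) x x) Y := by
  rw [hf.mvfderiv]
  have hr : Set.range (𝓡 m) = Set.univ := ModelWithCorners.range_eq_univ _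
  rw [hr, fderivWithin_univ]
  rfl

theorem chart_eventually_left_inv (x : L) :
    ∀ᶠ y in 𝓝 x, (extChartAt (𝓡 m) x).symm (extChartAt (𝓡 m) x y) = y := by
  filter_upwards [extChartAt_source_mem_nhds (I := 𝓡 m) x] with y hy
  exact (extChartAt (𝓡 m) x).left_inv hy

theorem contMDiffAt_chart (x : L) :
    ContMDiffAt (𝓡 m) 𝓘(ℝ, EuclideanSpace ℝ (Fin m)) ∞ (extChartAt (𝓡 m) x) x :=
  contMDiffAt_extChartAt

/-- A function is smooth at `x` if its expression in the preferred chart is. -/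
theorem contMDiffAt_of_eventuallyEq_comp_chart {f : L → F} (x : L)
    {h : EuclideanSpace ℝ (Fin m) → F} (hh : ContDiffAt ℝ ∞ h (extChartAt (𝓡 m) x x))
    (hfh : ∀ᶠ u in 𝓝 (extChartAt (𝓡 m) x x), f ((extChartAt (𝓡 m) x).symm u) = h u) :
    ContMDiffAt (𝓡 m) 𝓘(ℝ, F) ∞ f x := by
  have h1 : ContMDiffAt (𝓡 m) 𝓘(ℝ, F) ∞ (h ∘ extChartAt (𝓡 m) x) x :=
    hh.contMDiffAt.comp x (contMDiffAt_chart x)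
  refine h1.congr_of_eventuallyEq ?_
  filter_upwards [(continuousAt_extChartAt (I := 𝓡 m) x).eventually hfh,
    chart_eventually_left_inv (m := m) x] with y hy1 hy2
  rw [hy2] at hy1
  exact hy1

variable [IsManifold (𝓡 m) ∞ L]

theorem contMDiffAt_chart_symm (x : L) {u : EuclideanSpace ℝ (Fin m)}
    (hu : u ∈ (extChartAt (𝓡 m) x).target) :
    ContMDiffAt 𝓘(ℝ, EuclideanSpace ℝ (Fin m)) (𝓡 m) ∞ (extChartAt (𝓡 m) x).symm u :=
  (contMDiffOn_extChartAt_symm x).contMDiffAt ((isOpen_extChartAt_target x).mem_nhds hu)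

theorem contDiffAt_comp_chart_symm {f : L → F} (x : L) {u : EuclideanSpace ℝ (Fin m)}
    (hu : u ∈ (extChartAt (𝓡 m) x).target)
    (hf : ContMDiffAt (𝓡 m) 𝓘(ℝ, F) ∞ f ((extChartAt (𝓡 m) x).symm u)) :
    ContDiffAt ℝ ∞ (fun u => f ((extChartAt (𝓡 m) x).symm u)) u :=
  (hf.comp u (contMDiffAt_chart_symm x hu)).contDiffAt

theorem fderiv_comp_chart_symm {f : L → F} (x : L) {u : EuclideanSpace ℝ (Fin m)}
    (hu : u ∈ (extChartAt (𝓡 m) x).target)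
    (hf : MDifferentiableAt (𝓡 m) 𝓘(ℝ, F) f ((extChartAt (𝓡 m) x).symm u))
    (b : EuclideanSpace ℝ (Fin m)) :
    fderiv ℝ (fun u => f ((extChartAt (𝓡 m) x).symm u)) u b =
      mvfderiv (𝓡 m) f ((extChartAt (𝓡 m) x).symm u)
        (mfderiv 𝓘(ℝ, EuclideanSpace ℝ (Fin m)) (𝓡 m) (extChartAt (𝓡 m) x).symm u b) := by
  have h := mfderiv_comp u hf ((contMDiffAt_chart_symm x hu).mdifferentiableAt (by simp))
  have h' : fderiv ℝ (f ∘ (extChartAt (𝓡 m) x).symm) u =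
    mfderiv 𝓘(ℝ, EuclideanSpace ℝ (Fin m)) 𝓘(ℝ, F) (f ∘ (extChartAt (𝓡 m) x).symm) u :=
    mfderiv_eq_fderiv.symm
  exact (DFunLike.congr_fun h' b).trans (DFunLike.congr_fun h b)

theorem mfderiv_chart_symm_comp_mfderiv_chart (x : L) {u : EuclideanSpace ℝ (Fin m)}
    (hu : u ∈ (extChartAt (𝓡 m) x).target)
    (Y : TangentSpace (𝓡 m) ((extChartAt (𝓡 m) x).symm u)) :
    mfderiv 𝓘(ℝ, EuclideanSpace ℝ (Fin m)) (𝓡 m) (extChartAt (𝓡 m) x).symm u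
      (mvfderiv (𝓡 m) (extChartAt (𝓡 m) x) ((extChartAt (𝓡 m) x).symm u) Y) = Y := by
  have : IsManifold (𝓡 m) 1 L := IsManifold.of_le (n := ∞) (by simp)
  have h := mfderivWithin_extChartAt_symm_comp_mfderiv_extChartAt (I := 𝓡 m) hu
  have hr : Set.range (𝓡 m) = Set.univ := ModelWithCorners.range_eq_univ _
  rw [hr, mfderivWithin_univ] at h
  exact DFunLike.congr_fun h Y

theorem mfderiv_chart_comp_mfderiv_chart_symm (x : L) {u : EuclideanSpace ℝ (Fin m)}
    (hu : u ∈ (extChartAt (𝓡 m) x).target)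
    (b : EuclideanSpace ℝ (Fin m)) :
    mvfderiv (𝓡 m) (extChartAt (𝓡 m) x) ((extChartAt (𝓡 m) x).symm u)
    (mfderiv 𝓘(ℝ, EuclideanSpace ℝ (Fin m)) (𝓡 m) (extChartAt (𝓡 m) x).symm u b) = b := by
  have : IsManifold (𝓡 m) 1 L := IsManifold.of_le (n := ∞) (by simp)
  have h := mfderiv_extChartAt_comp_mfderivWithin_extChartAt_symm (I := 𝓡 m) hu
  have hr : Set.range (𝓡 m) = Set.univ := ModelWithCorners.range_eq_univ _
  rw [hr, mfderivWithin_univ] at h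
  exact DFunLike.congr_fun h b

/-- The tangent space at x is the model space by way of this very chart; hence vectors at the centre
may be identified with their components. -/
theorem mvfderiv_chart_self (x : L) (Y : TangentSpace (𝓡 m) x) :
    mvfderiv (𝓡 m) (extChartAt (𝓡 m) x) x Y = Y := by
  have : IsManifold (𝓡 m) 1 L := IsManifold.of_le (n := ∞) (by simp)
  exact DFunLike.congr_fun (mfderiv_extChartAt_self (I := 𝓡 m) (x := x)) Y

end Chart

/-! ### Gradient, Hessian and shape operator from ambient second derivatives -/

section LocalGeometry

variable {m : ℕ} {L : Type*} [TopologicalSpace L] [ChartedSpace (EuclideanSpace ℝ (Fin m)) L]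
  {E : Type*} [NormedAddCommGroup E] [InnerProductSpace ℝ E]

/-- The expression of a function in the preferred chart around `x`. -/
abbrev inChart (m : ℕ) [ChartedSpace (EuclideanSpace ℝ (Fin m)) L] {F : Type*} (x : L)
    (f : L → F) : EuclideanSpace ℝ (Fin m) → F :=
  fun u => f ((extChartAt (𝓡 m) x).symm u)

theorem contDiffAt_inChart_fderiv [IsManifold (𝓡 m) ∞ L] {F : Type*} [NormedAddCommGroup F]
    [NormedSpace ℝ F] {f : L → F} (hf : ContMDiff (𝓡 m) 𝓘(ℝ, F) ∞ f) (x : L)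
    {u : EuclideanSpace ℝ (Fin m)} (hu : u ∈ (extChartAt (𝓡 m) x).target) :
    ContDiffAt ℝ ∞ (fderiv ℝ (inChart m x f)) u :=
  (contDiffAt_comp_chart_symm x hu hf.contMDiffAt).fderiv_right (by simp)

theorem chart_target_mem_nhds (x : L) :
    ∀ᶠ u in 𝓝 (extChartAt (𝓡 m) x x), u ∈ (extChartAt (𝓡 m) x).target :=
  extChartAt_target_mem_nhds (I := 𝓡 m) x

theorem isSymm_fderiv_fderiv_inChart [IsManifold (𝓡 m) ∞ L] {F : Type*} [NormedAddCommGroup F]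
    [NormedSpace ℝ F] {f : L → F} (hf : ContMDiff (𝓡 m) 𝓘(ℝ, F) ∞ f) (x : L)
    (a b : EuclideanSpace ℝ (Fin m)) :
    fderiv ℝ (fderiv ℝ (inChart m x f)) (extChartAt (𝓡 m) x x) a b =
      fderiv ℝ (fderiv ℝ (inChart m x f)) (extChartAt (𝓡 m) x x) b a :=
  ((contDiffAt_comp_chart_symm x (mem_extChartAt_target x)
    hf.contMDiffAt).isSymmSndFDerivAt (by simpa using WithTop.coe_le_coe.mpr (le_top : (2 : ℕ∞) ≤ ⊤))) a b

theorem secondDeriv_symm [IsManifold (𝓡 m) ∞ L] {g : L → Metric.sphere (0 : E) 1}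
    (hg : ContMDiff (𝓡 m) 𝓘(ℝ, E) ∞ (fun y => (g y : E))) (x : L) (Y Z : TangentSpace (𝓡 m) x) :
    secondDeriv g x Y Z = secondDeriv g x Z Y :=
  isSymm_fderiv_fderiv_inChart hg x Y Z

variable [Bundle.RiemannianBundle (fun x : L => TangentSpace (𝓡 m) x)]

theorem inner_grad (τ : L → ℝ) (x : L) (Y : TangentSpace (𝓡 m) x) :
    ⟪grad τ x, Y⟫ = mvfderiv (𝓡 m) τ x Y :=
  inner_riesz _ _

/-- The normal projection in α_g is self-adjoint and fixes w, so it disappears when paired with w.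
-/
theorem inner_shapeOp [FiniteDimensional ℝ E] (g : L → Metric.sphere (0 : E) 1) (x : L) {w : E}
    (hw : w ∈ normalSpace m g x) (Y Z : TangentSpace (𝓡 m) x) :
    ⟪shapeOp g x w Y, Z⟫ = ⟪w, secondDeriv g x Y Z⟫ := by
  have h : ⟪shapeOp g x w Y, Z⟫ = ⟪w, (normalSpace m g x).starProjection (secondDeriv g x Y Z)⟫ :=
    inner_riesz _ _
  rw [h, ← Submodule.inner_starProjection_left_eq_right,
    Submodule.starProjection_eq_self_iff.mpr hw]

section Isometric

variable {g : L → Metric.sphere (0 : E) 1}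

theorem dMap_injective
    (hiso : ∀ (x : L) (Y Z : TangentSpace (𝓡 m) x), ⟪dMap g x Y, dMap g x Z⟫ = ⟪Y, Z⟫) (x : L) :
    Function.Injective (dMap (m := m) g x) := by
  rw [injective_iff_map_eq_zero]
  intro Y hY
  have h := hiso x Y Y
  rw [hY, inner_zero_left] at h
  exact inner_self_eq_zero.mp h.symm

theorem norm_dMap
    (hiso : ∀ (x : L) (Y Z : TangentSpace (𝓡 m) x), ⟪dMap g x Y, dMap g x Z⟫ = ⟪Y, Z⟫) (x : L)
    (Y : TangentSpace (𝓡 m) x) : ‖dMap g x Y‖ = ‖Y‖ := by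
  rw [norm_eq_sqrt_real_inner, norm_eq_sqrt_real_inner, hiso]

variable [IsManifold (𝓡 m) ∞ L] (hg : ContMDiff (𝓡 m) 𝓘(ℝ, E) ∞ (fun y => (g y : E)))
  (hiso : ∀ (x : L) (Y Z : TangentSpace (𝓡 m) x), ⟪dMap g x Y, dMap g x Z⟫ = ⟪Y, Z⟫)

include hg

omit [Bundle.RiemannianBundle (fun x : L => TangentSpace (𝓡 m) x)] in
theorem fderiv_inChart_immersion (x : L) {u : EuclideanSpace ℝ (Fin m)}
    (hu : u ∈ (extChartAt (𝓡 m) x).target) (b : EuclideanSpace ℝ (Fin m)) :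
    fderiv ℝ (inChart m x fun y => (g y : E)) u b = dMap g ((extChartAt (𝓡 m) x).symm u)
      (mfderiv 𝓘(ℝ, EuclideanSpace ℝ (Fin m)) (𝓡 m) (extChartAt (𝓡 m) x).symm u b) :=
  fderiv_comp_chart_symm x hu (hg.mdifferentiable (by simp) _) b

omit [Bundle.RiemannianBundle (fun x : L => TangentSpace (𝓡 m) x)]
  [IsManifold (𝓡 m) ∞ L] in
theorem dMap_eq_fderiv_inChart (x : L) (Y : TangentSpace (𝓡 m) x) :
    dMap g x Y = fderiv ℝ (inChart m x fun y => (g y : E)) (extChartAt (𝓡 m) x x) Y :=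
  mvfderiv_eq_fderiv_chart x (hg.mdifferentiable (by simp) _) Y

include hiso

theorem fderiv_inChart_immersion_injective (x : L) {u : EuclideanSpace ℝ (Fin m)}
    (hu : u ∈ (extChartAt (𝓡 m) x).target) :
    Function.Injective (fderiv ℝ (inChart m x fun y => (g y : E)) u) := by
  intro a b hab
  rw [fderiv_inChart_immersion hg x hu, fderiv_inChart_immersion hg x hu] at hab
  have h := dMap_injective hiso _ hab
  rw [← mfderiv_chart_comp_mfderiv_chart_symm x hu a, h,
    mfderiv_chart_comp_mfderiv_chart_symm x hu b]

/-- Isometry holds on the whole chart target, so derivatives of the metric can be read off from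
second derivatives of g. -/
theorem chartMetric_eq_gram (x : L) {u : EuclideanSpace ℝ (Fin m)}
    (hu : u ∈ (extChartAt (𝓡 m) x).target) :
    chartMetric x u = gram (fderiv ℝ (inChart m x fun y => (g y : E)) u) := by
  ext a b
  rw [gram_apply, fderiv_inChart_immersion hg x hu, fderiv_inChart_immersion hg x hu, hiso]
  rfl

variable {τ : L → ℝ} (hτ : ContMDiff (𝓡 m) 𝓘(ℝ, ℝ) ∞ τ)

include hτ

/-- The components of the gradient in the preferred chart. -/
theorem chartComponents_grad (x : L) {u : EuclideanSpace ℝ (Fin m)}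
    (hu : u ∈ (extChartAt (𝓡 m) x).target) :
    chartComponents x (grad (m := m) τ) ((extChartAt (𝓡 m) x).symm u) =
      (gram (fderiv ℝ (inChart m x fun y => (g y : E)) u)).inverse
        (fderiv ℝ (inChart m x τ) u) := by
  apply eq_gram_inverse (fderiv_inChart_immersion_injective hg hiso x hu)
  intro c
  rw [fderiv_inChart_immersion hg x hu, fderiv_inChart_immersion hg x hu, hiso, chartComponents,
    mfderiv_chart_symm_comp_mfderiv_chart x hu, inner_grad,
    fderiv_comp_chart_symm x hu (hτ.mdifferentiable (by simp) _)]

theorem dMap_grad_chart_symm (x : L) {u : EuclideanSpace ℝ (Fin m)}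
    (hu : u ∈ (extChartAt (𝓡 m) x).target) :
    dMap g ((extChartAt (𝓡 m) x).symm u) (grad (m := m) τ ((extChartAt (𝓡 m) x).symm u)) =
      fderiv ℝ (inChart m x fun y => (g y : E)) u
        ((gram (fderiv ℝ (inChart m x fun y => (g y : E)) u)).inverse
          (fderiv ℝ (inChart m x τ) u)) := by
  rw [← chartComponents_grad hg hiso hτ x hu, fderiv_inChart_immersion hg x hu, chartComponents,
    mfderiv_chart_symm_comp_mfderiv_chart x hu]

theorem contDiffAt_gradComponents (x : L) {u : EuclideanSpace ℝ (Fin m)}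
    (hu : u ∈ (extChartAt (𝓡 m) x).target) :
    ContDiffAt ℝ ∞ (fun u => (gram (fderiv ℝ (inChart m x fun y => (g y : E)) u)).inverse
      (fderiv ℝ (inChart m x τ) u)) u :=
  contDiffAt_gram_inverse (contDiffAt_inChart_fderiv hg x hu) (contDiffAt_inChart_fderiv hτ x hu)
    (fderiv_inChart_immersion_injective hg hiso x hu)

theorem contMDiff_dMap_grad : ContMDiff (𝓡 m) 𝓘(ℝ, E) ∞ fun y => dMap g y (grad (m := m) τ y) := by
  intro x
  have hu := mem_extChartAt_target (I := 𝓡 m) x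
  refine contMDiffAt_of_eventuallyEq_comp_chart x
    ((contDiffAt_inChart_fderiv hg x hu).clm_apply (contDiffAt_gradComponents hg hiso hτ x hu)) ?_
  filter_upwards [chart_target_mem_nhds (m := m) x] with v hv
  exact dMap_grad_chart_symm hg hiso hτ x hv

omit hτ in
-- The product rule for ⟨∂_b g, ∂_c g⟩, with b and c constant in the chart.
theorem dMetric_eq (x : L) (a b c : TangentSpace (𝓡 m) x) :
    dMetric x a b c = ⟪secondDeriv g x a b, dMap g x c⟫ + ⟪dMap g x b, secondDeriv g x a c⟫ := by
  have hu := mem_extChartAt_target (I := 𝓡 m) x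
  set B := fderiv ℝ (inChart m x fun y => (g y : E)) with hB
  have hBd : HasFDerivAt B (fderiv ℝ B (extChartAt (𝓡 m) x x)) (extChartAt (𝓡 m) x x) :=
    ((contDiffAt_inChart_fderiv hg x hu).differentiableAt (by simp)).hasFDerivAt
  have he : chartMetric (L := L) x =ᶠ[𝓝 (extChartAt (𝓡 m) x x)] fun u => gram (B u) := by
    filter_upwards [chart_target_mem_nhds (m := m) x] with u hu
    exact chartMetric_eq_gram hg hiso x hu
  have hd : DifferentiableAt ℝ (chartMetric (L := L) x) (extChartAt (𝓡 m) x x) := by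
    refine DifferentiableAt.congr_of_eventuallyEq ?_ he
    exact ((contDiff_gram.differentiable (by simp)).differentiableAt).comp _ hBd.differentiableAt
  let b' : EuclideanSpace ℝ (Fin m) := b
  let c' : EuclideanSpace ℝ (Fin m) := c
  have h1 : HasFDerivAt (fun u => chartMetric (L := L) x u b' c') _ (extChartAt (𝓡 m) x x) :=
    ((hd.hasFDerivAt.clm_apply (hasFDerivAt_const b' _)).clm_apply (hasFDerivAt_const c' _))
  have h2 : HasFDerivAt (fun u => ⟪B u b', B u c'⟫) _ (extChartAt (𝓡 m) x x) :=
    (hBd.clm_apply (hasFDerivAt_const b' _)).inner ℝ (hBd.clm_apply (hasFDerivAt_const c' _))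
  have h3 := h1.unique (h2.congr_of_eventuallyEq (he.mono fun u hu => by
    simp only [hu, gram_apply]))
  have h4 := DFunLike.congr_fun h3 a
  rw [dMap_eq_fderiv_inChart hg, dMap_eq_fderiv_inChart hg]
  simp at h4
  refine h4.trans ?_
  rw [add_comm]
  rfl

/-- Let B be dg in the chart and a the components of ∇τ. Differentiating ⟨B a, B Z⟩ = ∂_Z τ along Y
gives three terms. The one with a' and the one with B' acting on a add up to the covariant
derivative of ∇τ; the one with B' acting on Z is moved to the right. -/
theorem inner_hess (x : L) (Y Z : TangentSpace (𝓡 m) x) :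
    ⟪hess τ x Y, Z⟫ = fderiv ℝ (fderiv ℝ (inChart m x τ)) (extChartAt (𝓡 m) x x) Y Z -
      ⟪dMap g x (grad (m := m) τ x), secondDeriv g x Y Z⟫ := by
  have hu := mem_extChartAt_target (I := 𝓡 m) x
  set u₀ := extChartAt (𝓡 m) x x with hu₀
  set B := fderiv ℝ (inChart m x fun y => (g y : E)) with hB
  set a := fun u => (gram (B u)).inverse (fderiv ℝ (inChart m x τ) u) with ha
  have hBd : HasFDerivAt B (fderiv ℝ B u₀) u₀ :=
    ((contDiffAt_inChart_fderiv hg x hu).differentiableAt (by simp)).hasFDerivAt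
  have had : HasFDerivAt a (fderiv ℝ a u₀) u₀ :=
    ((contDiffAt_gradComponents hg hiso hτ x hu).differentiableAt (by simp)).hasFDerivAt
  have htd : HasFDerivAt (fderiv ℝ (inChart m x τ)) _ u₀ :=
    ((contDiffAt_inChart_fderiv hτ x hu).differentiableAt (by simp)).hasFDerivAt
  have hcomp : (fun u => chartComponents x (grad (m := m) τ) ((extChartAt (𝓡 m) x).symm u)) =ᶠ[𝓝 u₀] a := by
    filter_upwards [chart_target_mem_nhds (m := m) x] with u hu
    exact chartComponents_grad hg hiso hτ x hu
  have hsm : ContMDiffAt (𝓡 m) 𝓘(ℝ, EuclideanSpace ℝ (Fin m)) ∞ (chartComponents x (grad (m := m) τ)) x :=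
    contMDiffAt_of_eventuallyEq_comp_chart x (contDiffAt_gradComponents hg hiso hτ x hu) hcomp
  have hgrad : grad (m := m) τ x = a u₀ := by
    have h := hcomp.self_of_nhds
    simp only [hu₀, extChartAt_to_inv] at h
    rw [chartComponents, mvfderiv_chart_self] at h
    exact h
  have hdX : mvfderiv (𝓡 m) (chartComponents x (grad (m := m) τ)) x Y = fderiv ℝ a u₀ Y := by
    rw [mvfderiv_eq_fderiv_chart x (hsm.mdifferentiableAt (by simp)), hcomp.fderiv_eq]
  have hH : hess τ x Y = (show TangentSpace (𝓡 m) x from fderiv ℝ a u₀ Y) +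
      christoffel x Y (grad τ x) := by
    rw [← hdX]; rfl
  -- Expanding the Koszul formula gives six terms; by symmetry of the second derivative four cancel
  -- and the other two coincide.
  have hC : ⟪christoffel x Y (grad τ x), Z⟫ = ⟪secondDeriv g x Y (grad τ x), dMap g x Z⟫ := by
    have h : ⟪christoffel x Y (grad τ x), Z⟫ = (dMetric x Y (grad τ x) Z +
        dMetric x (grad τ x) Y Z - dMetric x Z Y (grad τ x)) / 2 := inner_riesz _ _
    rw [h, dMetric_eq hg hiso, dMetric_eq hg hiso, dMetric_eq hg hiso,
      secondDeriv_symm hg x (grad τ x) Y, secondDeriv_symm hg x (grad τ x) Z,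
      secondDeriv_symm hg x Z Y, real_inner_comm (dMap g x (grad (m := m) τ x)) (secondDeriv g x Y Z)]
    ring
  let Y' : EuclideanSpace ℝ (Fin m) := Y
  let Z' : EuclideanSpace ℝ (Fin m) := Z
  have h1 : HasFDerivAt (fun u => ⟪B u (a u), B u Z'⟫) _ u₀ :=
    (hBd.clm_apply had).inner ℝ (hBd.clm_apply (hasFDerivAt_const Z' _))
  have h2 : HasFDerivAt (fun u => fderiv ℝ (inChart m x τ) u Z') _ u₀ :=
    htd.clm_apply (hasFDerivAt_const Z' _)
  have h3 := h1.unique (h2.congr_of_eventuallyEq (by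
    filter_upwards [chart_target_mem_nhds (m := m) x] with u hu
    exact inner_gram_inverse (fderiv_inChart_immersion_injective hg hiso x hu) _ _))
  have h4 := DFunLike.congr_fun h3 Y'
  simp [inner_add_left] at h4
  rw [hH, inner_add_left, hC, ← hiso, dMap_eq_fderiv_inChart hg, dMap_eq_fderiv_inChart hg,
    dMap_eq_fderiv_inChart hg, hgrad]
  refine eq_sub_of_add_eq (Eq.trans ?_ h4)
  rw [add_comm]
  rfl

theorem hess_isSymmetric (x : L) : (hess (m := m) τ x).IsSymmetric := by
  intro Y Z
  rw [inner_hess hg hiso hτ, ← real_inner_comm Y, inner_hess hg hiso hτ, secondDeriv_symm hg x Y Z]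
  congr 1
  exact isSymm_fderiv_fderiv_inChart hτ x Y Z

omit hτ hiso in
theorem shapeOp_isSymmetric [FiniteDimensional ℝ E] (x : L) {w : E} (hw : w ∈ normalSpace m g x) :
    (shapeOp (m := m) g x w).IsSymmetric := by
  intro Y Z
  rw [inner_shapeOp g x hw, ← real_inner_comm Y, inner_shapeOp g x hw, secondDeriv_symm hg x Y Z]

end Isometric

end LocalGeometry

/-! ### Functions along curves -/

section Curves

variable {H₀ M₀ : Type*} {E₀ : Type*} [NormedAddCommGroup E₀] [NormedSpace ℝ E₀]
  [TopologicalSpace H₀] {I : ModelWithCorners ℝ E₀ H₀} [TopologicalSpace M₀] [ChartedSpace H₀ M₀]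
  {F : Type*} [NormedAddCommGroup F] [NormedSpace ℝ F]

theorem hasDerivAt_comp_curve {c : ℝ → M₀} {f : M₀ → F}
    (hc : MDifferentiableAt 𝓘(ℝ, ℝ) I c 0) (hf : MDifferentiableAt I 𝓘(ℝ, F) f (c 0)) :
    HasDerivAt (fun t => f (c t)) (mvfderiv I f (c 0) (mfderiv 𝓘(ℝ, ℝ) I c 0 (1 : ℝ))) 0 := by
  let D : ℝ →L[ℝ] F := (mvfderiv I f (c 0)).comp (mfderiv 𝓘(ℝ, ℝ) I c 0)
  have h : HasFDerivAt (fun t => f (c t)) D 0 :=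
    (hf.hasMFDerivAt.comp (0 : ℝ) hc.hasMFDerivAt).hasFDerivAt
  exact h.hasDerivAt

end Curves

/-! ### Tangent vectors of L × E -/

section Product

variable {m : ℕ} {L : Type*} [TopologicalSpace L] [ChartedSpace (EuclideanSpace ℝ (Fin m)) L]
  {E : Type*} [NormedAddCommGroup E] [InnerProductSpace ℝ E]

/-- The component along `L` of a tangent vector of `L × E`. -/
def baseComp (m : ℕ) [ChartedSpace (EuclideanSpace ℝ (Fin m)) L] (p : L × E) :
    TangentSpace ((𝓡 m).prod 𝓘(ℝ, E)) p →L[ℝ] TangentSpace (𝓡 m) p.1 :=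
  mfderiv ((𝓡 m).prod 𝓘(ℝ, E)) (𝓡 m) (Prod.fst : L × E → L) p

/-- The component along `E` of a tangent vector of `L × E`. -/
def fiberComp (m : ℕ) [ChartedSpace (EuclideanSpace ℝ (Fin m)) L] (p : L × E) :
    TangentSpace ((𝓡 m).prod 𝓘(ℝ, E)) p →L[ℝ] E :=
  mvfderiv ((𝓡 m).prod 𝓘(ℝ, E)) (Prod.snd : L × E → E) p

theorem tangent_ext {p : L × E} {V W : TangentSpace ((𝓡 m).prod 𝓘(ℝ, E)) p}
    (h1 : baseComp m p V = baseComp m p W) (h2 : fiberComp m p V = fiberComp m p W) : V = W := by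
  unfold baseComp at h1
  unfold fiberComp mvfderiv at h2
  rw [mfderiv_fst] at h1
  rw [mfderiv_snd] at h2
  exact Prod.ext h1 h2

/-- The velocity at time `0` of a curve in `L × E`. -/
abbrev velocity (m : ℕ) [ChartedSpace (EuclideanSpace ℝ (Fin m)) L] (c : ℝ → L × E) :
    TangentSpace ((𝓡 m).prod 𝓘(ℝ, E)) (c 0) :=
  mfderiv 𝓘(ℝ, ℝ) ((𝓡 m).prod 𝓘(ℝ, E)) c 0 (1 : ℝ)

variable {F : Type*} [NormedAddCommGroup F] [NormedSpace ℝ F]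

theorem hasDerivAt_comp_fst_curve {c : ℝ → L × E} {f : L → F}
    (hc : ContMDiffAt 𝓘(ℝ, ℝ) ((𝓡 m).prod 𝓘(ℝ, E)) ∞ c 0)
    (hf : MDifferentiableAt (𝓡 m) 𝓘(ℝ, F) f (c 0).1) :
    HasDerivAt (fun t => f (c t).1) (mvfderiv (𝓡 m) f (c 0).1 (baseComp m (c 0) (velocity m c)))
      0 := by
  have h := hf.hasMFDerivAt.comp (c 0)
    (mdifferentiableAt_fst (I := 𝓡 m) (I' := 𝓘(ℝ, E))).hasMFDerivAt
  let D : ℝ →L[ℝ] F := ((mvfderiv (𝓡 m) f (c 0).1).comp (baseComp m (c 0))).comp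
    (mfderiv 𝓘(ℝ, ℝ) ((𝓡 m).prod 𝓘(ℝ, E)) c 0)
  have h' : HasFDerivAt (fun t => f (c t).1) D 0 :=
    (h.comp (0 : ℝ) (hc.mdifferentiableAt (by simp)).hasMFDerivAt).hasFDerivAt
  exact h'.hasDerivAt

theorem hasDerivAt_snd_curve {c : ℝ → L × E}
    (hc : ContMDiffAt 𝓘(ℝ, ℝ) ((𝓡 m).prod 𝓘(ℝ, E)) ∞ c 0) :
    HasDerivAt (fun t => (c t).2) (fiberComp m (c 0) (velocity m c)) 0 :=
  hasDerivAt_comp_curve (hc.mdifferentiableAt (by simp)) mdifferentiableAt_snd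

theorem velocity_mem_tangentTo {S : Set (L × E)} {c : ℝ → L × E}
    (hc : ContMDiffAt 𝓘(ℝ, ℝ) ((𝓡 m).prod 𝓘(ℝ, E)) ∞ c 0) (hS : ∀ᶠ t in 𝓝 (0 : ℝ), c t ∈ S) :
    velocity m c ∈ tangentTo (m := m) S (c 0) :=
  Submodule.subset_span ⟨c, hc, hS, rfl, rfl⟩

/-- Two linear maps agree on the tangent space of `S` if they agree on the velocities of the curves
in `S`. -/
theorem eqOn_tangentTo {S : Set (L × E)} {p : L × E}
    {f₁ f₂ : TangentSpace ((𝓡 m).prod 𝓘(ℝ, E)) p →ₗ[ℝ] F}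
    (h : ∀ c : ℝ → L × E, ContMDiffAt 𝓘(ℝ, ℝ) ((𝓡 m).prod 𝓘(ℝ, E)) ∞ c 0 →
      (∀ᶠ t in 𝓝 (0 : ℝ), c t ∈ S) → ∀ hp : c 0 = p,
      f₁ (hp ▸ velocity m c) = f₂ (hp ▸ velocity m c))
    {V : TangentSpace ((𝓡 m).prod 𝓘(ℝ, E)) p} (hV : V ∈ tangentTo S p) : f₁ V = f₂ V := by
  refine LinearMap.eqOn_span ?_ hV
  rintro _ ⟨c, hc, hS, hp, rfl⟩
  exact h c hc hS hp

/-- The derivative of a function on `L × E` in the direction of `E`. -/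
theorem mvfderiv_eq_of_baseComp_eq_zero {f : L × E → F} {p : L × E}
    (hf : MDifferentiableAt ((𝓡 m).prod 𝓘(ℝ, E)) 𝓘(ℝ, F) f p)
    {V : TangentSpace ((𝓡 m).prod 𝓘(ℝ, E)) p} (hV : baseComp m p V = 0) {f' : F}
    (hf' : HasDerivAt (fun t : ℝ => f (p.1, p.2 + t • fiberComp m p V)) f' 0) :
    mvfderiv ((𝓡 m).prod 𝓘(ℝ, E)) f p V = f' := by
  set v := fiberComp m p V with hv
  -- A straight line in the fibre over p.1 realises V; it may leave Λ, since f is differentiable on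
  -- the ambient product.
  let c : ℝ → L × E := fun t => (p.1, p.2 + t • v)
  have hs : HasDerivAt (fun t : ℝ => p.2 + t • v) v 0 := by
    simpa using ((hasDerivAt_id (0 : ℝ)).smul_const v).const_add p.2
  have hc : ContMDiffAt 𝓘(ℝ, ℝ) ((𝓡 m).prod 𝓘(ℝ, E)) ∞ c 0 :=
    contMDiffAt_const.prodMk
      (contDiffAt_const.add (contDiffAt_id.smul contDiffAt_const)).contMDiffAt
  obtain ⟨x, w⟩ := p
  have hc0 : c 0 = (x, w) := by simp [c]
  have hbase : baseComp m (c 0) (velocity m c) = 0 := by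
    have h : HasMFDerivAt 𝓘(ℝ, ℝ) (𝓡 m) (fun t => (c t).1) 0 (0 : _ →L[ℝ] _) :=
      hasMFDerivAt_const x (0 : ℝ)
    have h' := (mdifferentiableAt_fst (I := 𝓡 m) (I' := 𝓘(ℝ, E)) (x := c 0)).hasMFDerivAt.comp
      (0 : ℝ) (hc.mdifferentiableAt (by simp)).hasMFDerivAt
    exact DFunLike.congr_fun (hasMFDerivAt_unique h' h) (1 : ℝ)
  have hfib : fiberComp m (c 0) (velocity m c) = v := (hasDerivAt_snd_curve hc).unique hs
  have hfc : MDifferentiableAt ((𝓡 m).prod 𝓘(ℝ, E)) 𝓘(ℝ, F) f (c 0) := by rwa [hc0]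
  have h := (hasDerivAt_comp_curve (hc.mdifferentiableAt (by simp)) hfc).unique hf'
  rw [← h]
  -- The base point is generalised so that the tangent spaces at c 0 and at (x, w) can be compared.
  have key : ∀ (q : L × E) (hq : q = (x, w)) (W : TangentSpace ((𝓡 m).prod 𝓘(ℝ, E)) q),
      baseComp m q W = 0 → fiberComp m q W = v →
      mvfderiv ((𝓡 m).prod 𝓘(ℝ, E)) f (x, w) V = mvfderiv ((𝓡 m).prod 𝓘(ℝ, E)) f q W := by
    rintro q rfl W h1 h2
    rw [tangent_ext (hV.trans h1.symm) (hv.symm.trans h2.symm)]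
  exact key (c 0) hc0 _ hbase hfib

end Product

/-! ### Normal spaces and differentiation of coordinate fields -/

section NormalBundle

variable {m : ℕ} {L : Type*} [TopologicalSpace L] [ChartedSpace (EuclideanSpace ℝ (Fin m)) L]
  {E : Type*} [NormedAddCommGroup E] [InnerProductSpace ℝ E]
  {g : L → Metric.sphere (0 : E) 1}

theorem mem_normalSpace_iff {x : L} {w : E} :
    w ∈ normalSpace m g x ↔ ⟪(g x : E), w⟫ = 0 ∧ ∀ Y, ⟪dMap (m := m) g x Y, w⟫ = 0 := by
  rw [normalSpace, ← Submodule.inf_orthogonal, Submodule.mem_inf,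
    Submodule.mem_orthogonal_singleton_iff_inner_right]
  refine and_congr_right fun _ => ?_
  rw [Submodule.mem_orthogonal]
  constructor
  · exact fun h Y => h _ ⟨Y, rfl⟩
  · rintro h _ ⟨Y, rfl⟩
    exact h Y

theorem norm_sphere_point {L E : Type*} [NormedAddCommGroup E] {g : L → Metric.sphere (0 : E) 1}
    (x : L) : ‖(g x : E)‖ = 1 := norm_eq_of_mem_sphere _

omit [TopologicalSpace L] in
theorem inner_sphere_point_self (x : L) : ⟪(g x : E), (g x : E)⟫ = 1 := by
  rw [real_inner_self_eq_norm_sq, norm_sphere_point]; norm_num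

variable [IsManifold (𝓡 m) ∞ L] (hg : ContMDiff (𝓡 m) 𝓘(ℝ, E) ∞ (fun y => (g y : E)))

include hg

/-- The derivative of the constant ⟨g, g⟩ = 1. -/
theorem inner_point_dMap (x : L) (Y : TangentSpace (𝓡 m) x) : ⟪(g x : E), dMap g x Y⟫ = 0 := by
  have hd : HasFDerivAt (inChart m x fun y => (g y : E)) _ (extChartAt (𝓡 m) x x) :=
    ((contDiffAt_comp_chart_symm x (mem_extChartAt_target x)
      hg.contMDiffAt).differentiableAt (by simp)).hasFDerivAt
  have h1 := hd.inner ℝ hd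
  have h2 : HasFDerivAt (fun u => ⟪inChart m x (fun y => (g y : E)) u,
      inChart m x (fun y => (g y : E)) u⟫) (0 : EuclideanSpace ℝ (Fin m) →L[ℝ] ℝ)
      (extChartAt (𝓡 m) x x) := by
    simp only [inChart, inner_sphere_point_self]
    exact hasFDerivAt_const _ _
  let Y' : EuclideanSpace ℝ (Fin m) := Y
  have h3 := DFunLike.congr_fun (h1.unique h2) Y'
  simp only [inChart, ContinuousLinearMap.coe_comp, Function.comp_apply,
    ContinuousLinearMap.prod_apply, fderivInnerCLM_apply, extChartAt_to_inv,
    zero_apply] at h3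
  rw [real_inner_comm, ← two_mul] at h3
  rw [real_inner_comm, dMap_eq_fderiv_inChart hg]
  exact (mul_eq_zero.mp h3).resolve_left two_ne_zero

omit hg in
/-- Differentiating the differential of a function in a chart. -/
theorem mdifferentiableAt_fderiv_inChart {F : Type*} [NormedAddCommGroup F] [NormedSpace ℝ F]
    {f : L → F} (hf : ContMDiff (𝓡 m) 𝓘(ℝ, F) ∞ f) (x : L) (Z : EuclideanSpace ℝ (Fin m)) :
    MDifferentiableAt (𝓡 m) 𝓘(ℝ, F)
      (fun y => fderiv ℝ (inChart m x f) (extChartAt (𝓡 m) x y) Z) x := by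
  refine ContMDiffAt.mdifferentiableAt (n := ∞) ?_ (by simp)
  have hd : ContDiffAt ℝ ∞ (fun u => fderiv ℝ (inChart m x f) u Z) (extChartAt (𝓡 m) x x) :=
    (contDiffAt_inChart_fderiv hf x (mem_extChartAt_target x)).clm_apply contDiffAt_const
  exact hd.contMDiffAt.comp x (contMDiffAt_chart x)

omit hg in
theorem mvfderiv_fderiv_inChart {F : Type*} [NormedAddCommGroup F] [NormedSpace ℝ F]
    {f : L → F} (hf : ContMDiff (𝓡 m) 𝓘(ℝ, F) ∞ f) (x : L) (Y : TangentSpace (𝓡 m) x)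
    (Z : EuclideanSpace ℝ (Fin m)) :
    mvfderiv (𝓡 m) (fun y => fderiv ℝ (inChart m x f) (extChartAt (𝓡 m) x y) Z) x Y =
      fderiv ℝ (fderiv ℝ (inChart m x f)) (extChartAt (𝓡 m) x x) Y Z := by
  rw [mvfderiv_eq_fderiv_chart x (mdifferentiableAt_fderiv_inChart hf x Z)]
  have he : (fun u => fderiv ℝ (inChart m x f)
      (extChartAt (𝓡 m) x ((extChartAt (𝓡 m) x).symm u)) Z) =ᶠ[𝓝 (extChartAt (𝓡 m) x x)]
      fun u => fderiv ℝ (inChart m x f) u Z := by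
    filter_upwards [chart_target_mem_nhds (m := m) x] with u hu
    rw [(extChartAt (𝓡 m) x).right_inv hu]
  rw [he.fderiv_eq]
  have hd : HasFDerivAt (fderiv ℝ (inChart m x f)) _ (extChartAt (𝓡 m) x x) :=
    ((contDiffAt_inChart_fderiv hf x (mem_extChartAt_target x)).differentiableAt
      (by simp)).hasFDerivAt
  have h := (hd.clm_apply (hasFDerivAt_const Z _)).fderiv
  let Y' : EuclideanSpace ℝ (Fin m) := Y
  have h' := DFunLike.congr_fun h Y'
  simp only [ContinuousLinearMap.comp_zero, zero_add] at h'
  exact h'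

omit hg in
theorem hasDerivAt_fderiv_inChart_curve {F : Type*} [NormedAddCommGroup F] [NormedSpace ℝ F]
    {f : L → F} (hf : ContMDiff (𝓡 m) 𝓘(ℝ, F) ∞ f) {c : ℝ → L × E}
    (hc : ContMDiffAt 𝓘(ℝ, ℝ) ((𝓡 m).prod 𝓘(ℝ, E)) ∞ c 0) (Z : EuclideanSpace ℝ (Fin m)) :
    HasDerivAt (fun t => fderiv ℝ (inChart m (c 0).1 f) (extChartAt (𝓡 m) (c 0).1 (c t).1) Z)
      (fderiv ℝ (fderiv ℝ (inChart m (c 0).1 f)) (extChartAt (𝓡 m) (c 0).1 (c 0).1)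
        (baseComp m (c 0) (velocity m c)) Z) 0 := by
  rw [← mvfderiv_fderiv_inChart hf]
  exact hasDerivAt_comp_fst_curve hc (mdifferentiableAt_fderiv_inChart hf (c 0).1 Z)

/-- Coordinate vectors of a chart as tangent vectors at nearby points. -/
theorem eventually_exists_coordinate_vector {τ : L → ℝ} (hτ : ContMDiff (𝓡 m) 𝓘(ℝ, ℝ) ∞ τ) (x : L)
    (Z : EuclideanSpace ℝ (Fin m)) :
    ∀ᶠ y in 𝓝 x, ∃ Z' : TangentSpace (𝓡 m) y,
      dMap g y Z' = fderiv ℝ (inChart m x fun y => (g y : E)) (extChartAt (𝓡 m) x y) Z ∧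
      mvfderiv (𝓡 m) τ y Z' = fderiv ℝ (inChart m x τ) (extChartAt (𝓡 m) x y) Z := by
  filter_upwards [extChartAt_source_mem_nhds (I := 𝓡 m) x] with y hy
  obtain ⟨u, hu, rfl⟩ : ∃ u ∈ (extChartAt (𝓡 m) x).target, (extChartAt (𝓡 m) x).symm u = y :=
    ⟨_, (extChartAt (𝓡 m) x).map_source hy, (extChartAt (𝓡 m) x).left_inv hy⟩
  rw [(extChartAt (𝓡 m) x).right_inv hu]
  -- One coordinate vector serves for g and for τ at once, as is needed to differentiate ⟨N, g_*Z⟩ =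
  -- dτ(Z).
  exact ⟨_, (fderiv_inChart_immersion hg x hu Z).symm,
    (fderiv_comp_chart_symm x hu (hτ.mdifferentiable (by simp) _) Z).symm⟩

end NormalBundle

/-! ### Tangent vectors of the unit normal bundle -/

section TangentUnitNormalBundle

variable {m : ℕ} {L : Type*} [TopologicalSpace L] [ChartedSpace (EuclideanSpace ℝ (Fin m)) L]
  {E : Type*} [NormedAddCommGroup E] [InnerProductSpace ℝ E]
  {g : L → Metric.sphere (0 : E) 1}
  (hg : ContMDiff (𝓡 m) 𝓘(ℝ, E) ∞ (fun y => (g y : E)))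
  {p : L × E} {V : TangentSpace ((𝓡 m).prod 𝓘(ℝ, E)) p}
  (hV : V ∈ tangentTo (unitNormalBundle m g) p)

include hV

/-- Differentiate ‖w‖² = 1 along curves in Λ. -/
theorem inner_fiberComp_snd : ⟪p.2, fiberComp m p V⟫ = 0 := by
  refine eqOn_tangentTo (f₁ := (innerSL ℝ p.2).toLinearMap ∘ₗ (fiberComp m p).toLinearMap)
    (f₂ := 0) ?_ hV
  rintro c hc hS rfl
  have h1 := (hasDerivAt_snd_curve hc).inner ℝ (hasDerivAt_snd_curve hc)
  have h2 := h1.unique ((hasDerivAt_const (0 : ℝ) (1 : ℝ)).congr_of_eventuallyEq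
    (hS.mono fun t ht => (real_inner_self_eq_norm_sq _).trans (by rw [ht.2]; norm_num)))
  rw [real_inner_comm, ← two_mul] at h2
  have h3 : ⟪(c 0).2, fiberComp m (c 0) (velocity m c)⟫ = 0 := by
    rw [real_inner_comm]; simpa using h2
  exact h3

include hg

/-- Differentiate ⟨g, w⟩ = 0; the term ⟨g_*Y, w⟩ drops out because w is normal. -/
theorem inner_fiberComp_point (hp : p ∈ unitNormalBundle m g) :
    ⟪(g p.1 : E), fiberComp m p V⟫ = 0 := by
  refine eqOn_tangentTo (f₁ := (innerSL ℝ (g p.1 : E)).toLinearMap ∘ₗ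
    (fiberComp m p).toLinearMap) (f₂ := 0) ?_ hV
  rintro c hc hS rfl
  have h0 : HasDerivAt (fun t => (g (c t).1 : E)) (dMap g (c 0).1
    (baseComp m (c 0) (velocity m c))) 0 :=
    hasDerivAt_comp_fst_curve (f := fun y => (g y : E)) hc (hg.mdifferentiable (by simp) _)
  have h1 := h0.inner ℝ (hasDerivAt_snd_curve hc)
  have h2 := h1.unique ((hasDerivAt_const (0 : ℝ) (0 : ℝ)).congr_of_eventuallyEq
    (hS.mono fun t ht => (mem_normalSpace_iff.mp ht.1).1))
  rw [(mem_normalSpace_iff.mp hp.1).2, add_zero] at h2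
  exact h2

/-- The Weingarten formula: differentiate ⟨∂_Z g, w⟩ = 0 along a curve in Λ, with Z constant in the
chart. The term containing the second derivative of g is ⟨A_w Y, Z⟩. -/
theorem inner_fiberComp_dMap [IsManifold (𝓡 m) ∞ L] [FiniteDimensional ℝ E]
    [Bundle.RiemannianBundle (fun x : L => TangentSpace (𝓡 m) x)]
    (hp : p ∈ unitNormalBundle m g) (Z : TangentSpace (𝓡 m) p.1) :
    ⟪dMap g p.1 Z, fiberComp m p V⟫ = -⟪Z, shapeOp g p.1 p.2 (baseComp m p V)⟫ := by
  refine eqOn_tangentTo (f₁ := (innerSL ℝ (dMap g p.1 Z)).toLinearMap ∘ₗ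
    (fiberComp m p).toLinearMap) (f₂ := -((innerSL ℝ Z).toLinearMap ∘ₗ shapeOp g p.1 p.2 ∘ₗ
      (baseComp m p).toLinearMap)) ?_ hV
  rintro c hc hS rfl
  have hd := hasDerivAt_fderiv_inChart_curve hg hc Z
  have h1 := hd.inner ℝ (hasDerivAt_snd_curve hc)
  have hcont : Filter.Tendsto (fun t => (c t).1) (𝓝 0) (𝓝 (c 0).1) :=
    (continuous_fst.continuousAt.comp hc.continuousAt)
  have h2 := h1.unique ((hasDerivAt_const (0 : ℝ) (0 : ℝ)).congr_of_eventuallyEq (by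
    -- The zero function stands in for τ, as only the identity for g is wanted.
    filter_upwards [hS, hcont.eventually (eventually_exists_coordinate_vector hg
      (contMDiff_const (c := (0 : ℝ))) (c 0).1 Z)] with t ht ⟨Z', hZ', _⟩
    rw [← hZ']
    exact (mem_normalSpace_iff.mp ht.1).2 Z'))
  have h3 : ⟪Z, shapeOp g (c 0).1 (c 0).2 (baseComp m (c 0) (velocity m c))⟫ =
      ⟪secondDeriv g (c 0).1 (baseComp m (c 0) (velocity m c)) Z, (c 0).2⟫ := by
    rw [← real_inner_comm, inner_shapeOp g _ hp.1, real_inner_comm]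
  have h4 : ⟪dMap g (c 0).1 Z, fiberComp m (c 0) (velocity m c)⟫ =
      -⟪Z, shapeOp g (c 0).1 (c 0).2 (baseComp m (c 0) (velocity m c))⟫ := by
    rw [h3, dMap_eq_fderiv_inChart hg]
    exact eq_neg_of_add_eq_zero_left h2
  exact h4

end TangentUnitNormalBundle

/-! ### The exponential map of the sphere -/

section SphereExp

variable {E : Type*} [NormedAddCommGroup E] [InnerProductSpace ℝ E]

/-- Away from 0 the norm is smooth and sinc t = sin t / t. This range suffices, as the argument in Ψ
has norm τ > 0. -/
theorem contDiffAt_sphereExp {q : E × E} (hq : q.2 ≠ 0) :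
    ContDiffAt ℝ ∞ (fun q : E × E => sphereExp q.1 q.2) q := by
  have hn : ContDiffAt ℝ ∞ (fun q : E × E => ‖q.2‖) q := contDiffAt_snd.norm ℝ hq
  have h : ContDiffAt ℝ ∞ (fun q : E × E =>
      Real.cos ‖q.2‖ • q.1 + (Real.sin ‖q.2‖ / ‖q.2‖) • q.2) q :=
    (hn.cos.smul contDiffAt_fst).add
      ((hn.sin.div hn (norm_ne_zero_iff.mpr hq)).smul contDiffAt_snd)
  refine h.congr_of_eventuallyEq ?_
  filter_upwards [continuous_snd.continuousAt.eventually_ne hq] with r hr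
  rw [sphereExp, Real.sinc_of_ne_zero (norm_ne_zero_iff.mpr hr)]

theorem sphereExp_neg_smul {p N : E} (hN : ‖N‖ = 1) {t : ℝ} (ht : 0 < t) :
    sphereExp p (-t • N) = Real.cos t • p - Real.sin t • N := by
  have h : ‖-t • N‖ = t := by rw [norm_smul, hN, norm_neg, Real.norm_of_nonneg ht.le, mul_one]
  rw [sphereExp, h, Real.sinc_of_ne_zero ht.ne', smul_smul, sub_eq_add_neg, ← neg_smul]
  congr 2
  field_simp

end SphereExp

/-! ### The direction N, the map Ψ and the field η -/

section Tube

variable {m : ℕ} {L : Type*} [TopologicalSpace L] [ChartedSpace (EuclideanSpace ℝ (Fin m)) L]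
  {E : Type*} [NormedAddCommGroup E] [InnerProductSpace ℝ E]
  [Bundle.RiemannianBundle (fun x : L => TangentSpace (𝓡 m) x)]
  {g : L → Metric.sphere (0 : E) 1} {τ : L → ℝ}

/-- The factor `√(1 - ‖∇τ‖²)`. -/
def normalFactor (m : ℕ) [ChartedSpace (EuclideanSpace ℝ (Fin m)) L]
    [Bundle.RiemannianBundle (fun x : L => TangentSpace (𝓡 m) x)] (τ : L → ℝ) (x : L) : ℝ :=
  √(1 - ‖grad (m := m) τ x‖ ^ 2)

theorem one_sub_normSq_grad_pos (hτ_grad : ∀ x, ‖grad (m := m) τ x‖ < 1) (x : L) :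
    0 < 1 - ‖grad (m := m) τ x‖ ^ 2 := by
  have h1 := hτ_grad x
  have h0 := norm_nonneg (grad (m := m) τ x)
  nlinarith

theorem normalFactor_pos (hτ_grad : ∀ x, ‖grad (m := m) τ x‖ < 1) (x : L) :
    0 < normalFactor m τ x :=
  Real.sqrt_pos.mpr (one_sub_normSq_grad_pos hτ_grad x)

theorem normalFactor_sq (hτ_grad : ∀ x, ‖grad (m := m) τ x‖ < 1) (x : L) :
    normalFactor m τ x ^ 2 = 1 - ‖grad (m := m) τ x‖ ^ 2 :=
  Real.sq_sqrt (one_sub_normSq_grad_pos hτ_grad x).le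

section Pointwise

variable (hiso : ∀ (x : L) (Y Z : TangentSpace (𝓡 m) x), ⟪dMap g x Y, dMap g x Z⟫ = ⟪Y, Z⟫)
  {p : L × E} (hp : p ∈ unitNormalBundle m g)

include hp

include hiso in
-- The purpose of the gradient term in N: this is what will make η normal to Ψ.
theorem inner_tubeDirection_dMap (Z : TangentSpace (𝓡 m) p.1) :
    ⟪tubeDirection m g τ p, dMap g p.1 Z⟫ = mvfderiv (𝓡 m) τ p.1 Z := by
  rw [tubeDirection, inner_add_left, inner_smul_left, hiso, inner_grad,
    real_inner_comm, (mem_normalSpace_iff.mp hp.1).2]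
  simp

include hiso in
theorem norm_tubeDirection (hτ_grad : ∀ x, ‖grad (m := m) τ x‖ < 1) :
    ‖tubeDirection m g τ p‖ = 1 := by
  have h : ‖tubeDirection m g τ p‖ ^ 2 = 1 := by
    rw [tubeDirection, norm_add_sq_real, norm_dMap hiso, norm_smul, hp.2, inner_smul_right,
      (mem_normalSpace_iff.mp hp.1).2, mul_one, Real.norm_eq_abs, sq_abs]
    have := normalFactor_sq hτ_grad p.1
    rw [normalFactor] at this
    rw [this]; ring
  exact (pow_eq_one_iff_of_nonneg (norm_nonneg _) two_ne_zero).mp h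

/-- This relies on ‖N‖ = 1, which comes from membership in Λ; the closed form is therefore
differentiated only along curves in Λ. -/
theorem tubeMap_eq (hiso : ∀ (x : L) (Y Z : TangentSpace (𝓡 m) x),
      ⟪dMap g x Y, dMap g x Z⟫ = ⟪Y, Z⟫)
    (hτ_pos : ∀ x, 0 < τ x) (hτ_grad : ∀ x, ‖grad (m := m) τ x‖ < 1) :
    tubeMap m g τ p =
      Real.cos (τ p.1) • (g p.1 : E) - Real.sin (τ p.1) • tubeDirection m g τ p :=
  sphereExp_neg_smul (norm_tubeDirection hiso hp hτ_grad) (hτ_pos _)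

variable [IsManifold (𝓡 m) ∞ L] (hg : ContMDiff (𝓡 m) 𝓘(ℝ, E) ∞ (fun y => (g y : E)))

include hg in
theorem inner_point_tubeDirection : ⟪(g p.1 : E), tubeDirection m g τ p⟫ = 0 := by
  rw [tubeDirection, inner_add_right, inner_smul_right, inner_point_dMap hg,
    (mem_normalSpace_iff.mp hp.1).1]
  simp

end Pointwise

variable [IsManifold (𝓡 m) ∞ L] (hg : ContMDiff (𝓡 m) 𝓘(ℝ, E) ∞ (fun y => (g y : E)))
  (hiso : ∀ (x : L) (Y Z : TangentSpace (𝓡 m) x), ⟪dMap g x Y, dMap g x Z⟫ = ⟪Y, Z⟫)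
  (hτ : ContMDiff (𝓡 m) 𝓘(ℝ, ℝ) ∞ τ) (hτ_pos : ∀ x, 0 < τ x)
  (hτ_grad : ∀ x, ‖grad (m := m) τ x‖ < 1)

section Smooth

include hg hiso hτ hτ_grad

/-- Replacing ‖∇τ‖ by ‖g_*∇τ‖ trades the varying norms on tangent spaces for the fixed norm of E.
The square root is smooth because ‖∇τ‖ < 1. -/
theorem contMDiff_normalFactor : ContMDiff (𝓡 m) 𝓘(ℝ, ℝ) ∞ (normalFactor m τ) := by
  intro x
  have h : ContMDiffAt (𝓡 m) 𝓘(ℝ, ℝ) ∞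
      (fun y => √(1 - ‖dMap g y (grad (m := m) τ y)‖ ^ 2)) x := by
    have hs : ContDiffAt ℝ ∞ (fun v : E => √(1 - ‖v‖ ^ 2)) (dMap g x (grad (m := m) τ x)) := by
      refine (contDiffAt_const.sub (contDiff_norm_sq ℝ).contDiffAt).sqrt ?_
      rw [norm_dMap hiso]
      exact (one_sub_normSq_grad_pos hτ_grad x).ne'
    exact ContMDiffAt.comp (g := fun v : E => √(1 - ‖v‖ ^ 2)) x hs.contMDiffAt
      (contMDiff_dMap_grad hg hiso hτ x)
  refine h.congr_of_eventuallyEq (Filter.Eventually.of_forall fun y => ?_)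
  change normalFactor m τ y = √(1 - ‖dMap g y (grad (m := m) τ y)‖ ^ 2)
  rw [norm_dMap hiso, normalFactor]

theorem contMDiff_tubeDirection :
    ContMDiff ((𝓡 m).prod 𝓘(ℝ, E)) 𝓘(ℝ, E) ∞ (tubeDirection m g τ) :=
  ((contMDiff_dMap_grad hg hiso hτ).comp contMDiff_fst).add
    (((contMDiff_normalFactor hg hiso hτ hτ_grad).comp contMDiff_fst).smul contMDiff_snd)

theorem contMDiff_tubeNormal :
    ContMDiff ((𝓡 m).prod 𝓘(ℝ, E)) 𝓘(ℝ, E) ∞ (tubeNormal m g τ) :=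
  (((Real.contDiff_sin.contMDiff.comp hτ).comp contMDiff_fst).smul (hg.comp contMDiff_fst)).add
    (((Real.contDiff_cos.contMDiff.comp hτ).comp contMDiff_fst).smul
      (contMDiff_tubeDirection hg hiso hτ hτ_grad))

include hτ_pos in
theorem contMDiffAt_tubeMap {p : L × E} (hp : p ∈ unitNormalBundle m g) :
    ContMDiffAt ((𝓡 m).prod 𝓘(ℝ, E)) 𝓘(ℝ, E) ∞ (tubeMap m g τ) p := by
  have hne : -(τ p.1) • tubeDirection m g τ p ≠ 0 := by
    refine smul_ne_zero (neg_ne_zero.mpr (hτ_pos _).ne') ?_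
    rw [← norm_ne_zero_iff, norm_tubeDirection hiso hp hτ_grad]
    exact one_ne_zero
  have hT : ContMDiffAt ((𝓡 m).prod 𝓘(ℝ, E)) 𝓘(ℝ, ℝ) ∞ (fun q : L × E => -τ q.1) p :=
    (hτ.comp contMDiff_fst).contMDiffAt.neg
  have hv : ContMDiffAt ((𝓡 m).prod 𝓘(ℝ, E)) 𝓘(ℝ, E) ∞
      (fun q : L × E => -(τ q.1) • tubeDirection m g τ q) p :=
    hT.smul (contMDiff_tubeDirection hg hiso hτ hτ_grad).contMDiffAt
  have hG : ContMDiffAt ((𝓡 m).prod 𝓘(ℝ, E)) 𝓘(ℝ, E) ∞ (fun q : L × E => (g q.1 : E)) p :=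
    (hg.comp contMDiff_fst).contMDiffAt
  have hs : ContMDiffAt 𝓘(ℝ, E × E) 𝓘(ℝ, E) ∞ (fun q : E × E => sphereExp q.1 q.2)
      ((g p.1 : E), -(τ p.1) • tubeDirection m g τ p) :=
    (contDiffAt_sphereExp hne).contMDiffAt
  exact ContMDiffAt.comp p hs (hG.prodMk_space hv)

end Smooth

/-! ### Differentials of N, η and Ψ on Λ -/

section Derivatives

variable {p : L × E} (hp : p ∈ unitNormalBundle m g)
  {V : TangentSpace ((𝓡 m).prod 𝓘(ℝ, E)) p}

/-- The differential of the field of directions `N = g_* ∇τ + √(1 - ‖∇τ‖²) w`. -/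
abbrev dDirection (m : ℕ) [ChartedSpace (EuclideanSpace ℝ (Fin m)) L]
    [Bundle.RiemannianBundle (fun x : L => TangentSpace (𝓡 m) x)]
    (g : L → Metric.sphere (0 : E) 1) (τ : L → ℝ) (p : L × E) :
    TangentSpace ((𝓡 m).prod 𝓘(ℝ, E)) p →L[ℝ] E :=
  mvfderiv ((𝓡 m).prod 𝓘(ℝ, E)) (tubeDirection m g τ) p

include hg hiso hτ hτ_grad

/-- Over a fixed point of L, the vector N is affine in w with slope ρ. -/
theorem dDirection_of_baseComp_eq_zero (hV : baseComp m p V = 0) :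
    dDirection m g τ p V = normalFactor m τ p.1 • fiberComp m p V := by
  refine mvfderiv_eq_of_baseComp_eq_zero
    ((contMDiff_tubeDirection hg hiso hτ hτ_grad).mdifferentiable (by simp) p) hV ?_
  have hs : HasDerivAt (fun t : ℝ => p.2 + t • fiberComp m p V) (fiberComp m p V) 0 := by
    simpa using ((hasDerivAt_id (0 : ℝ)).smul_const (fiberComp m p V)).const_add p.2
  exact (hs.const_smul (normalFactor m τ p.1)).const_add (dMap g p.1 (grad (m := m) τ p.1))

theorem hasDerivAt_tubeDirection_curve {c : ℝ → L × E}
    (hc : ContMDiffAt 𝓘(ℝ, ℝ) ((𝓡 m).prod 𝓘(ℝ, E)) ∞ c 0) :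
    HasDerivAt (fun t => tubeDirection m g τ (c t)) (dDirection m g τ (c 0) (velocity m c)) 0 :=
  hasDerivAt_comp_curve (hc.mdifferentiableAt (by simp))
    ((contMDiff_tubeDirection hg hiso hτ hτ_grad).mdifferentiable (by simp) _)

variable (hV : V ∈ tangentTo (unitNormalBundle m g) p)

include hV

/-- Differentiate ‖N‖² = 1 along curves in Λ. -/
theorem inner_tubeDirection_dDirection :
    ⟪tubeDirection m g τ p, dDirection m g τ p V⟫ = 0 := by
  refine eqOn_tangentTo (f₁ := (innerSL ℝ (tubeDirection m g τ p)).toLinearMap ∘ₗ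
    (dDirection m g τ p).toLinearMap) (f₂ := 0) ?_ hV
  rintro c hc hS rfl
  have h0 := hasDerivAt_tubeDirection_curve hg hiso hτ hτ_grad hc
  have h2 := (h0.inner ℝ h0).unique ((hasDerivAt_const (0 : ℝ) (1 : ℝ)).congr_of_eventuallyEq
    (hS.mono fun t ht => (real_inner_self_eq_norm_sq _).trans
      (by rw [norm_tubeDirection hiso ht hτ_grad]; norm_num)))
  rw [real_inner_comm, ← two_mul, real_inner_comm] at h2
  exact (mul_eq_zero.mp h2).resolve_left two_ne_zero

include hp

/-- Differentiate ⟨g, N⟩ = 0 and use ⟨N, g_*Y⟩ = dτ(Y). -/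
theorem inner_point_dDirection :
    ⟪(g p.1 : E), dDirection m g τ p V⟫ = -mvfderiv (𝓡 m) τ p.1 (baseComp m p V) := by
  refine eqOn_tangentTo (f₁ := (innerSL ℝ (g p.1 : E)).toLinearMap ∘ₗ
    (dDirection m g τ p).toLinearMap) (f₂ := -((mvfderiv (𝓡 m) τ p.1).toLinearMap ∘ₗ
      (baseComp m p).toLinearMap)) ?_ hV
  rintro c hc hS rfl
  have h0 : HasDerivAt (fun t => (g (c t).1 : E)) (dMap g (c 0).1
    (baseComp m (c 0) (velocity m c))) 0 :=
    hasDerivAt_comp_fst_curve (f := fun y => (g y : E)) hc (hg.mdifferentiable (by simp) _)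
  have h1 := h0.inner ℝ (hasDerivAt_tubeDirection_curve hg hiso hτ hτ_grad hc)
  have h2 := h1.unique ((hasDerivAt_const (0 : ℝ) (0 : ℝ)).congr_of_eventuallyEq
    (hS.mono fun t ht => inner_point_tubeDirection ht hg))
  rw [real_inner_comm _ (dMap _ _ _), inner_tubeDirection_dMap hiso hp] at h2
  exact eq_neg_of_add_eq_zero_left h2

/-- Differentiate ⟨∂_Z g, N⟩ = ∂_Z τ with Z constant in the chart, and split N in the term ⟨∂²g(Y,
Z), N⟩: its tangential part corrects ∂²τ to the Hessian by `inner_hess`, its normal part gives the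
shape operator. -/
theorem inner_dMap_dDirection [FiniteDimensional ℝ E] (Z : TangentSpace (𝓡 m) p.1) :
    ⟪dMap g p.1 Z, dDirection m g τ p V⟫ = ⟪Z, hess τ p.1 (baseComp m p V)⟫ -
      normalFactor m τ p.1 * ⟪Z, shapeOp g p.1 p.2 (baseComp m p V)⟫ := by
  rw [← real_inner_smul_right, ← inner_sub_right]
  refine eqOn_tangentTo (f₁ := (innerSL ℝ (dMap g p.1 Z)).toLinearMap ∘ₗ
    (dDirection m g τ p).toLinearMap) (f₂ := (innerSL ℝ Z).toLinearMap ∘ₗ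
      (hess τ p.1 - normalFactor m τ p.1 • shapeOp g p.1 p.2) ∘ₗ
      (baseComp m p).toLinearMap) ?_ hV
  rintro c hc hS rfl
  set Y := baseComp m (c 0) (velocity m c) with hY
  have hd := hasDerivAt_fderiv_inChart_curve hg hc Z
  have hdτ := hasDerivAt_fderiv_inChart_curve hτ hc Z
  have h1 := hd.inner ℝ (hasDerivAt_tubeDirection_curve hg hiso hτ hτ_grad hc)
  have hcont : Filter.Tendsto (fun t => (c t).1) (𝓝 0) (𝓝 (c 0).1) :=
    (continuous_fst.continuousAt.comp hc.continuousAt)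
  have h2 := h1.unique (hdτ.congr_of_eventuallyEq (by
    filter_upwards [hS, hcont.eventually (eventually_exists_coordinate_vector hg hτ (c 0).1 Z)]
      with t ht ⟨Z', hZ', hZτ⟩
    rw [← hZ', ← hZτ, real_inner_comm, inner_tubeDirection_dMap hiso ht]))
  change ⟪dMap g (c 0).1 Z, dDirection m g τ (c 0) (velocity m c)⟫ =
    ⟪Z, hess τ (c 0).1 Y - normalFactor m τ (c 0).1 • shapeOp g (c 0).1 (c 0).2 Y⟫
  rw [inner_sub_right, inner_smul_right, real_inner_comm _ Z, real_inner_comm _ Z,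
    inner_hess hg hiso hτ, inner_shapeOp g _ hp.1, dMap_eq_fderiv_inChart hg]
  have h3 : ⟪secondDeriv g (c 0).1 Y Z, tubeDirection m g τ (c 0)⟫ =
      ⟪dMap g (c 0).1 (grad (m := m) τ (c 0).1), secondDeriv g (c 0).1 Y Z⟫ +
        normalFactor m τ (c 0).1 * ⟪(c 0).2, secondDeriv g (c 0).1 Y Z⟫ := by
    rw [real_inner_comm, tubeDirection, inner_add_left, real_inner_smul_left]; rfl
  have h4 : ⟪fderiv ℝ (inChart m (c 0).1 fun y => (g y : E))
      (extChartAt (𝓡 m) (c 0).1 (c 0).1) Z, dDirection m g τ (c 0) (velocity m c)⟫ +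
      ⟪secondDeriv g (c 0).1 Y Z, tubeDirection m g τ (c 0)⟫ =
      fderiv ℝ (fderiv ℝ (inChart m (c 0).1 τ)) (extChartAt (𝓡 m) (c 0).1 (c 0).1) Y Z := h2
  rw [h3] at h4
  linarith

omit hp in
theorem mvfderiv_tubeNormal :
    mvfderiv ((𝓡 m).prod 𝓘(ℝ, E)) (tubeNormal m g τ) p V =
      mvfderiv (𝓡 m) τ p.1 (baseComp m p V) • (Real.cos (τ p.1) • (g p.1 : E) -
        Real.sin (τ p.1) • tubeDirection m g τ p) +
      Real.sin (τ p.1) • dMap g p.1 (baseComp m p V) +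
      Real.cos (τ p.1) • dDirection m g τ p V := by
  refine eqOn_tangentTo (f₁ := (mvfderiv ((𝓡 m).prod 𝓘(ℝ, E)) (tubeNormal m g τ) p).toLinearMap)
    (f₂ := ((mvfderiv (𝓡 m) τ p.1).toLinearMap ∘ₗ (baseComp m p).toLinearMap).smulRight
      (Real.cos (τ p.1) • (g p.1 : E) - Real.sin (τ p.1) • tubeDirection m g τ p) +
      Real.sin (τ p.1) • ((dMap g p.1).toLinearMap ∘ₗ (baseComp m p).toLinearMap) +
      Real.cos (τ p.1) • (dDirection m g τ p).toLinearMap) ?_ hV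
  rintro c hc hS rfl
  have hG : HasDerivAt (fun t => (g (c t).1 : E)) (dMap g (c 0).1
    (baseComp m (c 0) (velocity m c))) 0 :=
    hasDerivAt_comp_fst_curve (f := fun y => (g y : E)) hc (hg.mdifferentiable (by simp) _)
  have hN := hasDerivAt_tubeDirection_curve hg hiso hτ hτ_grad hc
  have hT := hasDerivAt_comp_fst_curve hc (hτ.mdifferentiable (by simp) _)
  have h1 : HasDerivAt (fun t => tubeNormal m g τ (c t)) _ 0 :=
    (hT.sin.smul hG).add (hT.cos.smul hN)
  have h2 := hasDerivAt_comp_curve (hc.mdifferentiableAt (by simp))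
    ((contMDiff_tubeNormal hg hiso hτ hτ_grad).mdifferentiable (by simp) (c 0))
  refine (h2.unique h1).trans ?_
  change _ = mvfderiv (𝓡 m) τ (c 0).1 (baseComp m (c 0) (velocity m c)) •
      (Real.cos (τ (c 0).1) • (g (c 0).1 : E) - Real.sin (τ (c 0).1) • tubeDirection m g τ (c 0)) +
      Real.sin (τ (c 0).1) • dMap g (c 0).1 (baseComp m (c 0) (velocity m c)) +
      Real.cos (τ (c 0).1) • dDirection m g τ (c 0) (velocity m c)
  module

include hτ_pos

theorem mvfderiv_tubeMap :
    mvfderiv ((𝓡 m).prod 𝓘(ℝ, E)) (tubeMap m g τ) p V =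
      -(mvfderiv (𝓡 m) τ p.1 (baseComp m p V) • tubeNormal m g τ p) +
      Real.cos (τ p.1) • dMap g p.1 (baseComp m p V) -
      Real.sin (τ p.1) • dDirection m g τ p V := by
  refine eqOn_tangentTo (f₁ := (mvfderiv ((𝓡 m).prod 𝓘(ℝ, E)) (tubeMap m g τ) p).toLinearMap)
    (f₂ := -(((mvfderiv (𝓡 m) τ p.1).toLinearMap ∘ₗ (baseComp m p).toLinearMap).smulRight
      (tubeNormal m g τ p)) +
      Real.cos (τ p.1) • ((dMap g p.1).toLinearMap ∘ₗ (baseComp m p).toLinearMap) -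
      Real.sin (τ p.1) • (dDirection m g τ p).toLinearMap) ?_ hV
  rintro c hc hS rfl
  have hG : HasDerivAt (fun t => (g (c t).1 : E)) (dMap g (c 0).1
    (baseComp m (c 0) (velocity m c))) 0 :=
    hasDerivAt_comp_fst_curve (f := fun y => (g y : E)) hc (hg.mdifferentiable (by simp) _)
  have hN := hasDerivAt_tubeDirection_curve hg hiso hτ hτ_grad hc
  have hT := hasDerivAt_comp_fst_curve hc (hτ.mdifferentiable (by simp) _)
  -- The curve stays in Λ near time 0, so the closed form of Ψ may be substituted before
  -- differentiating.
  have h1 : HasDerivAt (fun t => tubeMap m g τ (c t)) _ 0 :=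
    ((hT.cos.smul hG).sub (hT.sin.smul hN)).congr_of_eventuallyEq
      (hS.mono fun t ht => tubeMap_eq ht hiso hτ_pos hτ_grad)
  have h2 := hasDerivAt_comp_curve (hc.mdifferentiableAt (by simp))
    ((contMDiffAt_tubeMap hg hiso hτ hτ_pos hτ_grad hp).mdifferentiableAt (by simp))
  refine (h2.unique h1).trans ?_
  change _ = -(mvfderiv (𝓡 m) τ (c 0).1 (baseComp m (c 0) (velocity m c)) •
      (Real.sin (τ (c 0).1) • (g (c 0).1 : E) +
        Real.cos (τ (c 0).1) • tubeDirection m g τ (c 0))) +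
      Real.cos (τ (c 0).1) • dMap g (c 0).1 (baseComp m (c 0) (velocity m c)) -
      Real.sin (τ (c 0).1) • dDirection m g τ (c 0) (velocity m c)
  module

end Derivatives

end Tube

/-! ### Tangent vectors from explicit curves -/

section Curves

variable {m : ℕ} {L : Type*} [TopologicalSpace L] [ChartedSpace (EuclideanSpace ℝ (Fin m)) L]
  [IsManifold (𝓡 m) ∞ L] {E : Type*} [NormedAddCommGroup E] [InnerProductSpace ℝ E]

/-- A curve in `S` gives a tangent vector, with components the derivatives of the coordinates. -/
theorem exists_mem_tangentTo_of_curve {S : Set (L × E)} {p : L × E} {c : ℝ → L × E}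
    (hc : ContMDiffAt 𝓘(ℝ, ℝ) ((𝓡 m).prod 𝓘(ℝ, E)) ∞ c 0)
    (hS : ∀ᶠ t in 𝓝 (0 : ℝ), c t ∈ S) (h0 : c 0 = p) {b : EuclideanSpace ℝ (Fin m)} {v : E}
    (hb : HasDerivAt (fun t => extChartAt (𝓡 m) p.1 (c t).1) b 0)
    (hv : HasDerivAt (fun t => (c t).2) v 0) :
    ∃ V ∈ tangentTo (m := m) S p, baseComp m p V = b ∧ fiberComp m p V = v := by
  subst h0
  refine ⟨velocity m c, velocity_mem_tangentTo hc hS, ?_, (hasDerivAt_snd_curve hc).unique hv⟩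
  have h := (hasDerivAt_comp_fst_curve hc
    ((contMDiffAt_chart (m := m) (c 0).1).mdifferentiableAt (by simp))).unique hb
  rw [mvfderiv_chart_self] at h
  exact h

end Curves

/-! ### Vertical vectors and lifts in the tangent space of Λ -/

section UnitNormalBundle

variable {m : ℕ} {L : Type*} [TopologicalSpace L] [ChartedSpace (EuclideanSpace ℝ (Fin m)) L]
  {E : Type*} [NormedAddCommGroup E] [InnerProductSpace ℝ E]
  {g : L → Metric.sphere (0 : E) 1} [IsManifold (𝓡 m) ∞ L]

/-- The great circle from w in the direction v/‖v‖ stays in the unit sphere of the normal space. Its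
velocity is rescaled by ‖v‖ in the tangent space. -/
theorem exists_vertical_mem_tangentTo {p : L × E} (hp : p ∈ unitNormalBundle m g) {v : E}
    (hv : v ∈ normalSpace m g p.1) (hvw : ⟪p.2, v⟫ = 0) :
    ∃ V ∈ tangentTo (m := m) (unitNormalBundle m g) p,
      baseComp m p V = 0 ∧ fiberComp m p V = v := by
  rcases eq_or_ne v 0 with rfl | hv0
  · exact ⟨0, Submodule.zero_mem _, map_zero _, map_zero _⟩
  have hn : ‖v‖ ≠ 0 := norm_ne_zero_iff.mpr hv0
  set e : E := ‖v‖⁻¹ • v with he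
  have he1 : ‖e‖ = 1 := by rw [he, norm_smul, norm_inv, norm_norm, inv_mul_cancel₀ hn]
  have hwe : ⟪p.2, e⟫ = 0 := by rw [he, inner_smul_right, hvw, mul_zero]
  let c : ℝ → L × E := fun t => (p.1, Real.cos t • p.2 + Real.sin t • e)
  have hsm : ContDiffAt ℝ ∞ (fun t : ℝ => Real.cos t • p.2 + Real.sin t • e) 0 :=
    (Real.contDiff_cos.contDiffAt.smul contDiffAt_const).add
      (Real.contDiff_sin.contDiffAt.smul contDiffAt_const)
  have hc : ContMDiffAt 𝓘(ℝ, ℝ) ((𝓡 m).prod 𝓘(ℝ, E)) ∞ c 0 :=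
    contMDiffAt_const.prodMk hsm.contMDiffAt
  have hS : ∀ t, c t ∈ unitNormalBundle m g := fun t => by
    refine ⟨Submodule.add_mem _ (Submodule.smul_mem _ _ hp.1)
      (Submodule.smul_mem _ _ (Submodule.smul_mem _ _ hv)), ?_⟩
    have h : ‖Real.cos t • p.2 + Real.sin t • e‖ ^ 2 = 1 := by
      rw [norm_add_sq_real, norm_smul, norm_smul, hp.2, he1, real_inner_smul_left,
        real_inner_smul_right, hwe, mul_one, mul_one, Real.norm_eq_abs, Real.norm_eq_abs,
        sq_abs, sq_abs]
      linarith [Real.sin_sq_add_cos_sq t]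
    exact (pow_eq_one_iff_of_nonneg (norm_nonneg _) two_ne_zero).mp h
  have hd : HasDerivAt (fun t => (c t).2) e 0 := by
    refine (((Real.hasDerivAt_cos 0).smul_const p.2).add
      ((Real.hasDerivAt_sin 0).smul_const e)).congr_deriv ?_
    simp
  obtain ⟨V, hV, hV1, hV2⟩ := exists_mem_tangentTo_of_curve (p := p) hc
    (Filter.Eventually.of_forall hS) (by simp [c])
    (hasDerivAt_const (0 : ℝ) (extChartAt (𝓡 m) p.1 p.1)) hd
  refine ⟨‖v‖ • V, Submodule.smul_mem _ _ hV, ?_, ?_⟩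
  · exact Submodule.smul_mem (LinearMap.ker (baseComp m p).toLinearMap) _ hV1
  · rw [map_smul, hV2, he, smul_smul, mul_inv_cancel₀ hn, one_smul]

variable [Bundle.RiemannianBundle (fun x : L => TangentSpace (𝓡 m) x)]
  (hg : ContMDiff (𝓡 m) 𝓘(ℝ, E) ∞ (fun y => (g y : E)))
  (hiso : ∀ (x : L) (Y Z : TangentSpace (𝓡 m) x), ⟪dMap g x Y, dMap g x Z⟫ = ⟪Y, Z⟫)

include hg hiso

/-- Smooth local sections of the unit normal bundle. -/
theorem exists_local_section {p : L × E} (hp : p ∈ unitNormalBundle m g) :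
    ∃ s : EuclideanSpace ℝ (Fin m) → E, ContDiffAt ℝ ∞ s (extChartAt (𝓡 m) p.1 p.1) ∧
      s (extChartAt (𝓡 m) p.1 p.1) = p.2 ∧
      ∀ᶠ u in 𝓝 (extChartAt (𝓡 m) p.1 p.1),
        ((extChartAt (𝓡 m) p.1).symm u, s u) ∈ unitNormalBundle m g := by
  obtain ⟨x, w⟩ := p
  have hu := mem_extChartAt_target (I := 𝓡 m) x
  set u₀ := extChartAt (𝓡 m) x x with hu₀
  set γ := inChart m x fun y => (g y : E) with hγ
  set B := fderiv ℝ γ with hB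
  -- The constant vector w is projected to the normal space at each point: first its part in the
  -- range of dg is removed, then its part along g. At u₀ nothing is removed, so r is nonzero nearby
  -- and can be normalised.
  let r : EuclideanSpace ℝ (Fin m) → E := fun u =>
    w - B u ((gram (B u)).inverse ((innerSL ℝ w).comp (B u))) - ⟪γ u, w⟫ • γ u
  have hγs : ContDiffAt ℝ ∞ γ u₀ := contDiffAt_comp_chart_symm x hu hg.contMDiffAt
  have hBs : ContDiffAt ℝ ∞ B u₀ := contDiffAt_inChart_fderiv hg x hu
  have hrs : ContDiffAt ℝ ∞ r u₀ :=
    (contDiffAt_const.sub (hBs.clm_apply (contDiffAt_gram_inverse hBs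
      (contDiffAt_const.clm_comp hBs) (fderiv_inChart_immersion_injective hg hiso x hu)))).sub
      ((hγs.inner ℝ contDiffAt_const).smul hγs)
  have hw := mem_normalSpace_iff.mp hp.1
  have hγ0 : γ u₀ = g x := by simp only [hγ, inChart, hu₀, extChartAt_to_inv]
  have hr0 : r u₀ = w := by
    have h1 : (innerSL ℝ w).comp (B u₀) = 0 := by
      ext b
      change ⟪w, B u₀ b⟫ = 0
      rw [real_inner_comm, hB, hγ, hu₀, ← dMap_eq_fderiv_inChart hg x b]
      exact hw.2 b
    change w - B u₀ ((gram (B u₀)).inverse ((innerSL ℝ w).comp (B u₀))) - ⟪γ u₀, w⟫ • γ u₀ = w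
    rw [h1, hγ0, hw.1, map_zero, map_zero, zero_smul, sub_zero, sub_zero]
  have hrn : ∀ u ∈ (extChartAt (𝓡 m) x).target,
      r u ∈ normalSpace m g ((extChartAt (𝓡 m) x).symm u) := by
    intro u hu
    have hperp : ∀ b, ⟪γ u, B u b⟫ = 0 := fun b => by
      rw [hB, hγ, fderiv_inChart_immersion hg x hu]
      exact inner_point_dMap hg _ _
    have hγ1 : ⟪γ u, γ u⟫ = 1 := inner_sphere_point_self _
    refine mem_normalSpace_iff.mpr ⟨?_, fun Z => ?_⟩
    · change ⟪γ u, w - B u ((gram (B u)).inverse ((innerSL ℝ w).comp (B u))) -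
        ⟪γ u, w⟫ • γ u⟫ = 0
      rw [inner_sub_right, inner_sub_right, hperp, real_inner_smul_right, hγ1]
      ring
    · have hZ := fderiv_inChart_immersion hg x hu
        (mvfderiv (𝓡 m) (extChartAt (𝓡 m) x) ((extChartAt (𝓡 m) x).symm u) Z)
      rw [mfderiv_chart_symm_comp_mfderiv_chart x hu] at hZ
      rw [← hZ]
      set b := mvfderiv (𝓡 m) (extChartAt (𝓡 m) x) ((extChartAt (𝓡 m) x).symm u) Z
      change ⟪B u b, w - B u ((gram (B u)).inverse ((innerSL ℝ w).comp (B u))) -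
        ⟪γ u, w⟫ • γ u⟫ = 0
      rw [inner_sub_right, inner_sub_right, real_inner_comm _ (B u b),
        real_inner_comm _ (B u b), real_inner_smul_right, real_inner_comm _ (B u b), hperp,
        inner_gram_inverse (fderiv_inChart_immersion_injective hg hiso x hu)]
      simp
  have hne : r u₀ ≠ 0 := by
    rw [hr0, ← norm_ne_zero_iff, hp.2]
    exact one_ne_zero
  refine ⟨fun u => ‖r u‖⁻¹ • r u, ((hrs.norm ℝ hne).inv (norm_ne_zero_iff.mpr hne)).smul hrs,
    ?_, ?_⟩
  · change ‖r u₀‖⁻¹ • r u₀ = w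
    rw [hr0, hp.2, inv_one, one_smul]
  · filter_upwards [chart_target_mem_nhds (m := m) x, hrs.continuousAt.eventually_ne hne]
      with u hu hru
    refine ⟨Submodule.smul_mem _ _ (hrn u hu), ?_⟩
    rw [norm_smul, norm_inv, norm_norm, inv_mul_cancel₀ (norm_ne_zero_iff.mpr hru)]

/-- The projection of the tangent space of the unit normal bundle to the tangent space of `L` is
surjective. -/
theorem exists_lift_mem_tangentTo {p : L × E} (hp : p ∈ unitNormalBundle m g)
    (Y : TangentSpace (𝓡 m) p.1) :
    ∃ V ∈ tangentTo (m := m) (unitNormalBundle m g) p, baseComp m p V = Y := by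
  obtain ⟨s, hs, hs0, hsΛ⟩ := exists_local_section hg hiso hp
  let b : EuclideanSpace ℝ (Fin m) := Y
  set u₀ := extChartAt (𝓡 m) p.1 p.1 with hu₀
  -- The section s over this coordinate line is a curve in Λ whose projection to L has velocity Y.
  let ℓ : ℝ → EuclideanSpace ℝ (Fin m) := fun t => u₀ + t • b
  have hℓ0 : ℓ 0 = u₀ := by simp [ℓ]
  have hℓ : HasDerivAt ℓ b 0 := by
    exact (((hasDerivAt_id (0 : ℝ)).smul_const b).const_add u₀).congr_deriv (one_smul ℝ b)
  have hℓs : ContDiffAt ℝ ∞ ℓ 0 := contDiffAt_const.add (contDiffAt_id.smul contDiffAt_const)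
  have hℓc : Filter.Tendsto ℓ (𝓝 0) (𝓝 u₀) := by
    have h := hℓ.continuousAt.tendsto
    rwa [hℓ0] at h
  have hss : ContDiffAt ℝ ∞ (fun t => s (ℓ t)) 0 := by
    rw [← hℓ0] at hs
    exact hs.comp (0 : ℝ) hℓs
  have hφ : ContMDiffAt 𝓘(ℝ, EuclideanSpace ℝ (Fin m)) (𝓡 m) ∞ (extChartAt (𝓡 m) p.1).symm
      (ℓ 0) := by
    rw [hℓ0]
    exact contMDiffAt_chart_symm p.1 (mem_extChartAt_target p.1)
  have hc : ContMDiffAt 𝓘(ℝ, ℝ) ((𝓡 m).prod 𝓘(ℝ, E)) ∞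
      (fun t => ((extChartAt (𝓡 m) p.1).symm (ℓ t), s (ℓ t))) 0 :=
    (hφ.comp (0 : ℝ) hℓs.contMDiffAt).prodMk hss.contMDiffAt
  have hb : HasDerivAt
      (fun t => extChartAt (𝓡 m) p.1 ((extChartAt (𝓡 m) p.1).symm (ℓ t))) b 0 := by
    refine hℓ.congr_of_eventuallyEq ?_
    filter_upwards [hℓc.eventually (chart_target_mem_nhds (m := m) p.1)] with t ht
    exact (extChartAt (𝓡 m) p.1).right_inv ht
  obtain ⟨V, hV, hV1, -⟩ := exists_mem_tangentTo_of_curve (p := p) hc (hℓc.eventually hsΛ)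
    (by rw [hℓ0, hs0, hu₀, extChartAt_to_inv]) hb
    (hss.differentiableAt (by simp)).hasDerivAt
  exact ⟨V, hV, hV1⟩

end UnitNormalBundle

section Frame

/-! ### Orthonormal pairs and hypersurfaces, infinitesimally -/

variable {T E : Type*} [AddCommGroup T] [Module ℝ T]
  [NormedAddCommGroup E] [InnerProductSpace ℝ E] [FiniteDimensional ℝ E]

/-- An injective linear map of corank two whose values are orthogonal to an orthonormal pair has the
orthogonal complement of the pair as its range. -/
theorem range_eq_of_orthonormal_pair {f : T →ₗ[ℝ] E} (hf : Function.Injective f)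
    (hdim : Module.finrank ℝ T + 2 = Module.finrank ℝ E) {a b : E} (ha : ⟪a, a⟫ = 1)
    (hb : ⟪b, b⟫ = 1) (hab : ⟪a, b⟫ = 0) (hfa : ∀ V, ⟪a, f V⟫ = 0) (hfb : ∀ V, ⟪b, f V⟫ = 0) :
    LinearMap.range f = (Submodule.span ℝ {a, b})ᗮ := by
  have hle : LinearMap.range f ≤ (Submodule.span ℝ {a, b})ᗮ := by
    rintro _ ⟨V, rfl⟩
    rw [Submodule.mem_orthogonal]
    intro u hu
    obtain ⟨r, s, rfl⟩ := Submodule.mem_span_pair.mp hu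
    rw [inner_add_left, real_inner_smul_left, real_inner_smul_left, hfa, hfb]
    ring
  have hli : LinearIndependent ℝ ![a, b] := by
    rw [LinearIndependent.pair_iff]
    intro r s h
    have h1 := congrArg (fun z => ⟪a, z⟫) h
    have h2 := congrArg (fun z => ⟪b, z⟫) h
    simp only [inner_add_right, real_inner_smul_right, inner_zero_right, ha, hb, hab,
      real_inner_comm a b] at h1 h2
    exact ⟨by linarith, by linarith⟩
  have h2 : Module.finrank ℝ (Submodule.span ℝ {a, b}) = 2 := by
    have h := finrank_span_eq_card hli
    rwa [Matrix.range_cons_cons_empty, Fintype.card_fin] at h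
  have h3 := Submodule.finrank_add_finrank_orthogonal (Submodule.span ℝ {a, b})
  have h4 := LinearMap.finrank_range_of_inj hf
  exact Submodule.eq_of_le_of_finrank_eq hle (by omega)

/-- The unit normals of an infinitesimal hypersurface of the sphere. -/
theorem unit_normal_iff {f : T →ₗ[ℝ] E} (hf : Function.Injective f)
    (hdim : Module.finrank ℝ T + 2 = Module.finrank ℝ E) {a b : E} (ha : ⟪a, a⟫ = 1)
    (hb : ⟪b, b⟫ = 1) (hab : ⟪a, b⟫ = 0) (hfa : ∀ V, ⟪a, f V⟫ = 0) (hfb : ∀ V, ⟪b, f V⟫ = 0)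
    (ν : E) :
    (‖ν‖ = 1 ∧ ⟪ν, a⟫ = 0 ∧ ∀ V, ⟪ν, f V⟫ = 0) ↔ ν = b ∨ ν = -b := by
  have hb1 : ‖b‖ = 1 := by
    rw [real_inner_self_eq_norm_sq] at hb
    exact (pow_eq_one_iff_of_nonneg (norm_nonneg _) two_ne_zero).mp hb
  constructor
  · rintro ⟨h1, h2, h3⟩
    -- By the dimension count ν lies in the plane of a and b; orthogonality to a leaves only
    -- multiples of b.
    have hν : ν ∈ ((Submodule.span ℝ {a, b})ᗮ)ᗮ := by
      rw [← range_eq_of_orthonormal_pair hf hdim ha hb hab hfa hfb, Submodule.mem_orthogonal]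
      rintro _ ⟨V, rfl⟩
      rw [real_inner_comm, h3]
    rw [Submodule.orthogonal_orthogonal] at hν
    obtain ⟨r, s, rfl⟩ := Submodule.mem_span_pair.mp hν
    have hr : r = 0 := by
      rw [inner_add_left, real_inner_smul_left, real_inner_smul_left, ha, real_inner_comm, hab]
        at h2
      linarith
    subst hr
    rw [zero_smul, zero_add, norm_smul, hb1, mul_one, Real.norm_eq_abs] at h1
    rcases eq_or_eq_neg_of_abs_eq h1 with rfl | rfl
    · left; simp
    · right; simp
  · rintro (rfl | rfl)
    · exact ⟨hb1, by rw [real_inner_comm, hab], hfb⟩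
    · refine ⟨by rw [norm_neg, hb1], by rw [inner_neg_left, real_inner_comm, hab, neg_zero],
        fun V => by rw [inner_neg_left, hfb, neg_zero]⟩

end Frame

/-- The infinitesimal data of a tube at a point: `T` is the tangent space of the unit normal bundle,
with components `y` in the tangent space `H` of the submanifold and `v` in the ambient space. -/
structure TubeData (T H E : Type*) [AddCommGroup T] [Module ℝ T] [NormedAddCommGroup H]
    [InnerProductSpace ℝ H] [NormedAddCommGroup E] [InnerProductSpace ℝ E] where
  y : T →ₗ[ℝ] H
  v : T →ₗ[ℝ] E
  dG : H →ₗ[ℝ] E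
  dN : T →ₗ[ℝ] E
  hs : H →ₗ[ℝ] H
  sh : H →ₗ[ℝ] H
  G : E
  w : E
  q : H
  ρ : ℝ
  c : ℝ
  s : ℝ
  inj : ∀ V, y V = 0 → v V = 0 → V = 0
  lift : ∀ Y, ∃ V, y V = Y
  vert : ∀ e, ⟪G, e⟫ = 0 → (∀ Z, ⟪dG Z, e⟫ = 0) → ⟪w, e⟫ = 0 → ∃ V, y V = 0 ∧ v V = e
  iso : ∀ Y Z, ⟪dG Y, dG Z⟫ = ⟪Y, Z⟫
  inner_G_G : ⟪G, G⟫ = 1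
  inner_w_w : ⟪w, w⟫ = 1
  inner_G_w : ⟪G, w⟫ = 0
  inner_G_dG : ∀ Y, ⟪G, dG Y⟫ = 0
  inner_dG_w : ∀ Y, ⟪dG Y, w⟫ = 0
  inner_w_v : ∀ V, ⟪w, v V⟫ = 0
  inner_G_v : ∀ V, ⟪G, v V⟫ = 0
  inner_dG_v : ∀ V Z, ⟪dG Z, v V⟫ = -⟪Z, sh (y V)⟫
  norm_q : ‖q‖ < 1
  ρ_pos : 0 < ρ
  ρ_sq : ρ ^ 2 = 1 - ‖q‖ ^ 2
  s_pos : 0 < s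
  sq_add_sq : s ^ 2 + c ^ 2 = 1
  inner_N_dN : ∀ V, ⟪dG q + ρ • w, dN V⟫ = 0
  inner_G_dN : ∀ V, ⟪G, dN V⟫ = -⟪q, y V⟫
  inner_dG_dN : ∀ V Z, ⟪dG Z, dN V⟫ = ⟪Z, hs (y V)⟫ - ρ * ⟪Z, sh (y V)⟫
  dN_of_y_eq_zero : ∀ V, y V = 0 → dN V = ρ • v V

/-! ### Linear algebra of the tube at one point -/

namespace TubeData

variable {T H E : Type*} [AddCommGroup T] [Module ℝ T] [NormedAddCommGroup H]
  [InnerProductSpace ℝ H] [NormedAddCommGroup E] [InnerProductSpace ℝ E] (D : TubeData T H E)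

/-- The direction of the tube. -/
def N : E := D.dG D.q + D.ρ • D.w

/-- The point of the tube. -/
def F : E := D.c • D.G - D.s • D.N

/-- The normal vector of the tube. -/
def η : E := D.s • D.G + D.c • D.N

/-- The differential of the tube. -/
def dF : T →ₗ[ℝ] E :=
  -(((innerSL ℝ D.q).toLinearMap ∘ₗ D.y).smulRight D.η) + D.c • (D.dG ∘ₗ D.y) - D.s • D.dN

/-- The differential of the normal vector. -/
def dη : T →ₗ[ℝ] E :=
  ((innerSL ℝ D.q).toLinearMap ∘ₗ D.y).smulRight D.F + D.s • (D.dG ∘ₗ D.y) + D.c • D.dN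

/-- The endomorphism which is nonsingular exactly at the regular points. -/
def P : H →ₗ[ℝ] H :=
  D.c • (LinearMap.id - (innerSL ℝ D.q).toLinearMap.smulRight D.q) - D.s • D.hs +
    (D.s * D.ρ) • D.sh

theorem dF_apply (V : T) :
    D.dF V = -(⟪D.q, D.y V⟫ • D.η) + D.c • D.dG (D.y V) - D.s • D.dN V := rfl

theorem dη_apply (V : T) :
    D.dη V = ⟪D.q, D.y V⟫ • D.F + D.s • D.dG (D.y V) + D.c • D.dN V := rfl

theorem P_apply (Y : H) :
    D.P Y = D.c • (Y - ⟪D.q, Y⟫ • D.q) - D.s • D.hs Y + (D.s * D.ρ) • D.sh Y := rfl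

theorem inner_G_N : ⟪D.G, D.N⟫ = 0 := by
  rw [N, inner_add_right, real_inner_smul_right, D.inner_G_dG, D.inner_G_w]; ring

theorem inner_N_N : ⟪D.N, D.N⟫ = 1 := by
  rw [N, inner_add_left, inner_add_right, inner_add_right, real_inner_smul_left,
    real_inner_smul_left, real_inner_smul_right, real_inner_smul_right, D.iso, D.inner_w_w,
    real_inner_comm _ D.w, D.inner_dG_w, real_inner_self_eq_norm_sq]
  linarith [D.ρ_sq]

theorem inner_N_dG (Z : H) : ⟪D.N, D.dG Z⟫ = ⟪D.q, Z⟫ := by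
  rw [N, inner_add_left, real_inner_smul_left, D.iso, real_inner_comm _ D.w, D.inner_dG_w]; ring

theorem inner_F_F : ⟪D.F, D.F⟫ = 1 := by
  simp only [F, inner_sub_left, inner_sub_right, real_inner_smul_left, real_inner_smul_right,
    D.inner_G_G, D.inner_G_N, D.inner_N_N, real_inner_comm D.G D.N]
  linarith [D.sq_add_sq]

theorem inner_η_η : ⟪D.η, D.η⟫ = 1 := by
  simp only [η, inner_add_left, inner_add_right, real_inner_smul_left, real_inner_smul_right,
    D.inner_G_G, D.inner_G_N, D.inner_N_N, real_inner_comm D.G D.N]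
  linarith [D.sq_add_sq]

theorem inner_F_η : ⟪D.F, D.η⟫ = 0 := by
  simp only [F, η, inner_sub_left, inner_add_right, real_inner_smul_left, real_inner_smul_right,
    D.inner_G_G, D.inner_G_N, D.inner_N_N, real_inner_comm D.G D.N]
  ring

theorem inner_F_dG (Z : H) : ⟪D.F, D.dG Z⟫ = -(D.s * ⟪D.q, Z⟫) := by
  rw [F, inner_sub_left, real_inner_smul_left, real_inner_smul_left, D.inner_G_dG, D.inner_N_dG]
  ring

theorem inner_η_dG (Z : H) : ⟪D.η, D.dG Z⟫ = D.c * ⟪D.q, Z⟫ := by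
  rw [η, inner_add_left, real_inner_smul_left, real_inner_smul_left, D.inner_G_dG, D.inner_N_dG]
  ring

theorem inner_F_dN (V : T) : ⟪D.F, D.dN V⟫ = -(D.c * ⟪D.q, D.y V⟫) := by
  have h : ⟪D.N, D.dN V⟫ = 0 := D.inner_N_dN V
  rw [F, inner_sub_left, real_inner_smul_left, real_inner_smul_left, D.inner_G_dN, h]
  ring

theorem inner_η_dN (V : T) : ⟪D.η, D.dN V⟫ = -(D.s * ⟪D.q, D.y V⟫) := by
  have h : ⟪D.N, D.dN V⟫ = 0 := D.inner_N_dN V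
  rw [η, inner_add_left, real_inner_smul_left, real_inner_smul_left, D.inner_G_dN, h]
  ring

theorem inner_F_dF (V : T) : ⟪D.F, D.dF V⟫ = 0 := by
  rw [dF_apply, inner_sub_right, inner_add_right, inner_neg_right, real_inner_smul_right,
    real_inner_smul_right, real_inner_smul_right, D.inner_F_η, D.inner_F_dG, D.inner_F_dN]
  ring

/-- The three terms of dF contribute -1, c² and s² times ⟨q, y V⟩. -/
theorem inner_η_dF (V : T) : ⟪D.η, D.dF V⟫ = 0 := by
  rw [dF_apply, inner_sub_right, inner_add_right, inner_neg_right, real_inner_smul_right,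
    real_inner_smul_right, real_inner_smul_right, D.inner_η_η, D.inner_η_dG, D.inner_η_dN]
  linear_combination ⟪D.q, D.y V⟫ * D.sq_add_sq

theorem inner_F_dη (V : T) : ⟪D.F, D.dη V⟫ = 0 := by
  rw [dη_apply, inner_add_right, inner_add_right, real_inner_smul_right,
    real_inner_smul_right, real_inner_smul_right, D.inner_F_F, D.inner_F_dG, D.inner_F_dN]
  linear_combination -⟪D.q, D.y V⟫ * D.sq_add_sq

theorem inner_η_dη (V : T) : ⟪D.η, D.dη V⟫ = 0 := by
  rw [dη_apply, inner_add_right, inner_add_right, real_inner_smul_right,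
    real_inner_smul_right, real_inner_smul_right, real_inner_comm D.F, D.inner_F_η, D.inner_η_dG,
    D.inner_η_dN]
  ring

/-- The origin of P: its rank-one term comes from η, its operators `hs` and `sh` from dN. -/
theorem inner_dG_dF (V : T) (Z : H) : ⟪D.dG Z, D.dF V⟫ = ⟪Z, D.P (D.y V)⟫ := by
  have h : ⟪D.dG Z, D.η⟫ = D.c * ⟪Z, D.q⟫ := by
    rw [real_inner_comm, D.inner_η_dG, real_inner_comm]
  rw [dF_apply, P_apply]
  simp only [inner_sub_right, inner_add_right, inner_neg_right, real_inner_smul_right, h, D.iso,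
    D.inner_dG_dN]
  ring

theorem dF_of_y_eq_zero {V : T} (hV : D.y V = 0) : D.dF V = -((D.s * D.ρ) • D.v V) := by
  rw [dF_apply, hV, D.dN_of_y_eq_zero V hV, map_zero, inner_zero_right, zero_smul, smul_zero,
    smul_smul]
  simp

/-- This combination eliminates dN, and s F - c η = -N. -/
theorem s_smul_dη_add_c_smul_dF (V : T) :
    D.s • D.dη V + D.c • D.dF V = D.dG (D.y V) - ⟪D.q, D.y V⟫ • D.N := by
  have h1 : D.s • D.dη V + D.c • D.dF V = (D.s ^ 2 + D.c ^ 2) • D.dG (D.y V) -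
      (⟪D.q, D.y V⟫ * (D.s ^ 2 + D.c ^ 2)) • D.N := by
    rw [dη_apply, dF_apply, F, η]
    module
  rw [h1, D.sq_add_sq, one_smul, mul_one]

/-- Taking norms, ‖Y‖ = |⟨q, Y⟩| ≤ ‖q‖ ‖Y‖. The strict bound ‖q‖ < 1 is what excludes non-vertical
eigenvectors. -/
theorem eq_zero_of_dG_eq_smul_N {Y : H} (h : D.dG Y = ⟪D.q, Y⟫ • D.N) : Y = 0 := by
  have h1 : ‖Y‖ ^ 2 = ⟪D.q, Y⟫ ^ 2 := by
    rw [← real_inner_self_eq_norm_sq, ← D.iso, h, real_inner_smul_left, real_inner_smul_right,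
      D.inner_N_N]
    ring
  by_contra hY
  have h2 : 0 < ‖Y‖ := norm_pos_iff.mpr hY
  have h3 : |⟪D.q, Y⟫| ≤ ‖D.q‖ * ‖Y‖ := abs_real_inner_le_norm _ _
  have h4 : ‖D.q‖ * ‖Y‖ < ‖Y‖ := by nlinarith [D.norm_q]
  have h5 : ⟪D.q, Y⟫ ^ 2 < ‖Y‖ ^ 2 := sq_lt_sq' (by linarith [neg_abs_le ⟪D.q, Y⟫])
    (lt_of_le_of_lt (le_abs_self _) (lt_of_le_of_lt h3 h4))
  linarith

theorem dη_eq_iff (V : T) : D.dη V = -((D.c / D.s) • D.dF V) ↔ D.y V = 0 := by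
  have hs := D.s_pos.ne'
  have h1 : D.dη V = -((D.c / D.s) • D.dF V) ↔ D.s • D.dη V + D.c • D.dF V = 0 := by
    constructor
    · intro h
      rw [h, smul_neg, smul_smul, mul_div_cancel₀ _ hs, neg_add_cancel]
    · intro h
      rw [← smul_right_injective E hs |>.eq_iff]
      change D.s • D.dη V = D.s • -((D.c / D.s) • D.dF V)
      rw [smul_neg, smul_smul, mul_div_cancel₀ _ hs]
      exact eq_neg_of_add_eq_zero_left h
  rw [h1, s_smul_dη_add_c_smul_dF]
  constructor
  · exact fun h => D.eq_zero_of_dG_eq_smul_N (sub_eq_zero.mp h)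
  · intro h
    rw [h, map_zero, inner_zero_right, zero_smul, sub_zero]

/-- If P kills y V, then dF V is also the image of a vertical vector, and injectivity of dF makes V
vertical. Conversely, if P is injective, a vector in the kernel of dF is vertical, where dF is a
nonzero multiple of the injective v. -/
theorem injective_dF_iff : Function.Injective D.dF ↔ Function.Injective D.P := by
  rw [injective_iff_map_eq_zero, injective_iff_map_eq_zero]
  have hsρ : D.s * D.ρ ≠ 0 := (mul_pos D.s_pos D.ρ_pos).ne'
  constructor
  · intro hinj Y hY
    obtain ⟨V, rfl⟩ := D.lift Y
    have hdG : ∀ Z, ⟪D.dG Z, D.dF V⟫ = 0 := fun Z => by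
      rw [D.inner_dG_dF, hY, inner_zero_right]
    have hF := D.inner_F_dF V
    have hη := D.inner_η_dF V
    rw [F, inner_sub_left, real_inner_smul_left, real_inner_smul_left] at hF
    rw [η, inner_add_left, real_inner_smul_left, real_inner_smul_left] at hη
    -- Undo the rotation: orthogonality to F and η passes to G and N, and then to w because ρ ≠ 0.
    have hG : ⟪D.G, D.dF V⟫ = 0 := by
      linear_combination D.c * hF + D.s * hη - ⟪D.G, D.dF V⟫ * D.sq_add_sq
    have hN : ⟪D.N, D.dF V⟫ = 0 := by
      linear_combination -D.s * hF + D.c * hη - ⟪D.N, D.dF V⟫ * D.sq_add_sq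
    have hw : ⟪D.w, D.dF V⟫ = 0 := by
      rw [N, inner_add_left, real_inner_smul_left, hdG, zero_add] at hN
      exact (mul_eq_zero.mp hN).resolve_left D.ρ_pos.ne'
    obtain ⟨W, hW, hWv⟩ := D.vert _ hG hdG hw
    -- The factor compensates for dF = -sρ v on vertical vectors.
    have h1 : D.dF (V + (D.s * D.ρ)⁻¹ • W) = 0 := by
      rw [map_add, map_smul, D.dF_of_y_eq_zero hW, hWv, smul_neg, smul_smul,
        inv_mul_cancel₀ hsρ, one_smul, add_neg_cancel]
    have h2 := congrArg D.y (hinj _ h1)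
    rwa [map_add, map_smul, hW, smul_zero, add_zero, map_zero] at h2
  · intro hinj V hV
    have hy : D.y V = 0 := by
      apply hinj
      refine ext_inner_left ℝ fun Z => ?_
      rw [← D.inner_dG_dF, hV, inner_zero_right, inner_zero_right]
    refine D.inj V hy ?_
    rw [D.dF_of_y_eq_zero hy, neg_eq_zero] at hV
    exact (smul_eq_zero.mp hV).resolve_left hsρ

variable [FiniteDimensional ℝ H] [FiniteDimensional ℝ E]

/-- The map v identifies the vertical space with the orthogonal complement of dG(H) ⊕ ℝG ⊕ ℝw, and
that sum is direct. -/
theorem finrank_ker_y :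
    Module.finrank ℝ (LinearMap.ker D.y) + 2 + Module.finrank ℝ H = Module.finrank ℝ E := by
  let Θ : (H × ℝ × ℝ) →ₗ[ℝ] E := D.dG.coprod
    ((LinearMap.toSpanSingleton ℝ E D.G).coprod (LinearMap.toSpanSingleton ℝ E D.w))
  have hΘ : ∀ Z a b, Θ (Z, a, b) = D.dG Z + (a • D.G + b • D.w) := fun Z a b => rfl
  have hinj : Function.Injective Θ := by
    rw [injective_iff_map_eq_zero]
    rintro ⟨Z, a, b⟩ h
    rw [hΘ] at h
    have hGd := D.inner_G_dG Z
    have hdw := D.inner_dG_w Z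
    have ha := congrArg (fun z => ⟪D.G, z⟫) h
    have hb := congrArg (fun z => ⟪D.w, z⟫) h
    simp only [inner_add_right, real_inner_smul_right, inner_zero_right, hGd, D.inner_G_G,
      D.inner_G_w, D.inner_w_w, real_inner_comm (D.dG Z) D.w, hdw,
      real_inner_comm D.G D.w] at ha hb
    obtain rfl : a = 0 := by linarith
    obtain rfl : b = 0 := by linarith
    rw [zero_smul, zero_smul, add_zero, add_zero] at h
    have hZ := D.iso Z Z
    rw [h, inner_zero_left] at hZ
    rw [inner_self_eq_zero.mp hZ.symm]
    rfl
  have hmap : (LinearMap.ker D.y).map D.v = (LinearMap.range Θ)ᗮ := by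
    ext e
    rw [Submodule.mem_map, Submodule.mem_orthogonal]
    constructor
    · rintro ⟨V, hV, rfl⟩ _ ⟨⟨Z, a, b⟩, rfl⟩
      rw [hΘ, inner_add_left, inner_add_left, real_inner_smul_left, real_inner_smul_left,
        D.inner_dG_v, LinearMap.mem_ker.mp hV, D.inner_G_v, D.inner_w_v]
      simp
    · intro h
      refine D.vert e ?_ (fun Z => ?_) ?_
      · simpa [hΘ] using h _ ⟨(0, 1, 0), rfl⟩
      · simpa [hΘ] using h _ ⟨(Z, 0, 0), rfl⟩
      · simpa [hΘ] using h _ ⟨(0, 0, 1), rfl⟩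
  have hker : Module.finrank ℝ ((LinearMap.ker D.y).map D.v) =
      Module.finrank ℝ (LinearMap.ker D.y) := by
    have hi : Function.Injective (D.v ∘ₗ (LinearMap.ker D.y).subtype) := by
      rw [injective_iff_map_eq_zero]
      rintro ⟨V, hV⟩ h
      exact Subtype.ext (D.inj V hV h)
    rw [← LinearMap.finrank_range_of_inj hi, LinearMap.range_comp, Submodule.range_subtype]
  have h1 := Submodule.finrank_add_finrank_orthogonal (LinearMap.range Θ)
  rw [← hmap, hker, LinearMap.finrank_range_of_inj hinj] at h1
  simp only [Module.finrank_prod, Module.finrank_self] at h1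
  omega

variable [FiniteDimensional ℝ T]

include D in
-- Rank-nullity for the surjection y. With E of dimension n + 2 this says that Λ has dimension n.
theorem finrank_add_two : Module.finrank ℝ T + 2 = Module.finrank ℝ E := by
  have h1 := LinearMap.finrank_range_add_finrank_ker D.y
  rw [LinearMap.range_eq_top.mpr D.lift, finrank_top] at h1
  have h2 := D.finrank_ker_y
  omega

theorem unit_normal_iff (hinj : Function.Injective D.dF) (ν : E) :
    (‖ν‖ = 1 ∧ ⟪ν, D.F⟫ = 0 ∧ ∀ V, ⟪ν, D.dF V⟫ = 0) ↔ ν = D.η ∨ ν = -D.η :=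
  SphereTube.unit_normal_iff hinj D.finrank_add_two D.inner_F_F D.inner_η_η D.inner_F_η
    D.inner_F_dF D.inner_η_dF ν

/-- The values of dη are orthogonal to F and η, hence lie in the range of dF, and A is -dF⁻¹ ∘ dη.
The strict inequality of dimensions makes the vertical space nonzero, so that c/s is an eigenvalue.
-/
theorem exists_shape_operator (hinj : Function.Injective D.dF)
    (hdim : Module.finrank ℝ H + 2 < Module.finrank ℝ E) :
    ∃ A : Module.End ℝ T, (∀ B : Module.End ℝ T, (∀ V, D.dη V = -D.dF (B V)) ↔ B = A) ∧
      A.HasEigenvalue (D.c / D.s) ∧ A.eigenspace (D.c / D.s) = LinearMap.ker D.y := by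
  have hr := range_eq_of_orthonormal_pair hinj D.finrank_add_two D.inner_F_F D.inner_η_η
    D.inner_F_η D.inner_F_dF D.inner_η_dF
  have hmem : ∀ V, D.dη V ∈ LinearMap.range D.dF := fun V => by
    rw [hr, Submodule.mem_orthogonal]
    intro u hu
    obtain ⟨r, s, rfl⟩ := Submodule.mem_span_pair.mp hu
    rw [inner_add_left, real_inner_smul_left, real_inner_smul_left, D.inner_F_dη, D.inner_η_dη]
    ring
  let A : Module.End ℝ T :=
    -((LinearEquiv.ofInjective D.dF hinj).symm.toLinearMap ∘ₗ D.dη.codRestrict _ hmem)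
  have hA : ∀ V, D.dF (A V) = -D.dη V := fun V => by
    have h := LinearEquiv.apply_symm_apply (LinearEquiv.ofInjective D.dF hinj)
      (D.dη.codRestrict _ hmem V)
    have h' := congrArg Subtype.val h
    change D.dF (-((LinearEquiv.ofInjective D.dF hinj).symm (D.dη.codRestrict _ hmem V))) = _
    rw [map_neg]
    exact congrArg Neg.neg h'
  have heig : A.eigenspace (D.c / D.s) = LinearMap.ker D.y := by
    ext V
    rw [Module.End.mem_eigenspace_iff, LinearMap.mem_ker, ← D.dη_eq_iff, ← hinj.eq_iff, hA,
      map_smul, neg_eq_iff_eq_neg]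
  refine ⟨A, fun B => ⟨fun h => ?_, ?_⟩, ?_, heig⟩
  · ext V
    apply hinj
    rw [hA, h, neg_neg]
  · rintro rfl V
    rw [hA, neg_neg]
  · change A.eigenspace (D.c / D.s) ≠ ⊥
    rw [heig]
    intro h
    have h1 := D.finrank_ker_y
    rw [h, finrank_bot] at h1
    omega

end TubeData

/-! ### The geometric objects as an instance of the linear algebra -/

section TubeDataOfImmersion

variable {m : ℕ} {L : Type*} [TopologicalSpace L] [ChartedSpace (EuclideanSpace ℝ (Fin m)) L]
  {E : Type*} [NormedAddCommGroup E] [InnerProductSpace ℝ E]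
  [Bundle.RiemannianBundle (fun x : L => TangentSpace (𝓡 m) x)]
  {g : L → Metric.sphere (0 : E) 1} {τ : L → ℝ} [IsManifold (𝓡 m) ∞ L]

instance finiteDimensional_tangentTo [FiniteDimensional ℝ E] (S : Set (L × E)) (p : L × E) :
    FiniteDimensional ℝ (tangentTo (m := m) S p) :=
  haveI : FiniteDimensional ℝ (TangentSpace ((𝓡 m).prod 𝓘(ℝ, E)) p) :=
    inferInstanceAs (FiniteDimensional ℝ (EuclideanSpace ℝ (Fin m) × E))
  inferInstance

variable [FiniteDimensional ℝ E]
  (hg : ContMDiff (𝓡 m) 𝓘(ℝ, E) ∞ (fun y => (g y : E)))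
  (hiso : ∀ (x : L) (Y Z : TangentSpace (𝓡 m) x), ⟪dMap g x Y, dMap g x Z⟫ = ⟪Y, Z⟫)
  (hτ : ContMDiff (𝓡 m) 𝓘(ℝ, ℝ) ∞ τ) (hτ_mem : ∀ x, τ x ∈ Set.Ioo 0 (Real.pi / 2))
  (hτ_grad : ∀ x, ‖grad (m := m) τ x‖ < 1)
  {p : L × E} (hp : p ∈ unitNormalBundle m g)

/-- The infinitesimal data of the tube at a point of the unit normal bundle. -/
def tubeData : TubeData (tangentTo (m := m) (unitNormalBundle m g) p) (TangentSpace (𝓡 m) p.1)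
    E where
  y := (baseComp m p).toLinearMap ∘ₗ (tangentTo (unitNormalBundle m g) p).subtype
  v := (fiberComp m p).toLinearMap ∘ₗ (tangentTo (unitNormalBundle m g) p).subtype
  dG := (dMap g p.1).toLinearMap
  dN := (dDirection m g τ p).toLinearMap ∘ₗ (tangentTo (unitNormalBundle m g) p).subtype
  hs := hess τ p.1
  sh := shapeOp g p.1 p.2
  G := g p.1
  w := p.2
  q := grad τ p.1
  ρ := normalFactor m τ p.1
  c := Real.cos (τ p.1)
  s := Real.sin (τ p.1)
  inj V h1 h2 := Subtype.ext (tangent_ext (h1.trans (map_zero _).symm) (h2.trans (map_zero _).symm))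
  lift Y := by
    obtain ⟨V, hV, h⟩ := exists_lift_mem_tangentTo hg hiso hp Y
    exact ⟨⟨V, hV⟩, h⟩
  vert e h1 h2 h3 := by
    obtain ⟨V, hV, h⟩ := exists_vertical_mem_tangentTo hp (mem_normalSpace_iff.mpr ⟨h1, h2⟩) h3
    exact ⟨⟨V, hV⟩, h⟩
  iso := hiso p.1
  inner_G_G := inner_sphere_point_self _
  inner_w_w := by rw [real_inner_self_eq_norm_sq, hp.2]; norm_num
  inner_G_w := (mem_normalSpace_iff.mp hp.1).1
  inner_G_dG := inner_point_dMap hg p.1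
  inner_dG_w := (mem_normalSpace_iff.mp hp.1).2
  inner_w_v V := inner_fiberComp_snd V.2
  inner_G_v V := inner_fiberComp_point hg V.2 hp
  inner_dG_v V Z := inner_fiberComp_dMap hg V.2 hp Z
  norm_q := hτ_grad p.1
  ρ_pos := normalFactor_pos hτ_grad p.1
  ρ_sq := normalFactor_sq hτ_grad p.1
  s_pos := Real.sin_pos_of_pos_of_lt_pi (hτ_mem p.1).1
    (by linarith [(hτ_mem p.1).2, Real.pi_pos])
  sq_add_sq := Real.sin_sq_add_cos_sq _
  inner_N_dN V := inner_tubeDirection_dDirection hg hiso hτ hτ_grad V.2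
  inner_G_dN V := (inner_point_dDirection hg hiso hτ hτ_grad hp V.2).trans
    (congrArg Neg.neg (inner_grad τ p.1 _).symm)
  inner_dG_dN V Z := inner_dMap_dDirection hg hiso hτ hτ_grad hp V.2 Z
  dN_of_y_eq_zero _ hV := dDirection_of_baseComp_eq_zero hg hiso hτ hτ_grad hV

theorem tubeData_η : (tubeData hg hiso hτ hτ_mem hτ_grad hp).η = tubeNormal m g τ p := rfl

theorem tubeData_P :
    (tubeData hg hiso hτ hτ_mem hτ_grad hp).P = tubeP g τ p.1 p.2 := rfl

theorem tubeData_F : (tubeData hg hiso hτ hτ_mem hτ_grad hp).F = tubeMap m g τ p :=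
  (tubeMap_eq hp hiso (fun x => (hτ_mem x).1) hτ_grad).symm

theorem tubeData_dF :
    (tubeData hg hiso hτ hτ_mem hτ_grad hp).dF =
      diffOn (unitNormalBundle m g) (tubeMap m g τ) p := by
  ext V
  refine Eq.trans ?_
    (mvfderiv_tubeMap hg hiso hτ (fun x => (hτ_mem x).1) hτ_grad hp V.2).symm
  rw [← inner_grad]
  rfl

theorem tubeData_dη :
    (tubeData hg hiso hτ hτ_mem hτ_grad hp).dη =
      diffOn (unitNormalBundle m g) (tubeNormal m g τ) p := by
  ext V
  refine Eq.trans ?_ (mvfderiv_tubeNormal hg hiso hτ hτ_grad V.2).symm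
  rw [← inner_grad]
  rfl

include hg hiso hτ in
theorem tubeP_isSymmetric {x : L} {w : E} (hw : w ∈ normalSpace m g x) :
    (tubeP (m := m) g τ x w).IsSymmetric := by
  intro Y Z
  have h1 := hess_isSymmetric hg hiso hτ x Y Z
  have h2 := shapeOp_isSymmetric hg x hw Y Z
  change ⟪Real.cos (τ x) • (Y - ⟪grad τ x, Y⟫ • grad τ x) - Real.sin (τ x) • hess τ x Y +
      (Real.sin (τ x) * √(1 - ‖grad (m := m) τ x‖ ^ 2)) • shapeOp g x w Y, Z⟫ =
    ⟪Y, Real.cos (τ x) • (Z - ⟪grad τ x, Z⟫ • grad τ x) - Real.sin (τ x) • hess τ x Z +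
      (Real.sin (τ x) * √(1 - ‖grad (m := m) τ x‖ ^ 2)) • shapeOp g x w Z⟫
  simp only [inner_add_left, inner_sub_left, inner_add_right, inner_sub_right,
    real_inner_smul_left, real_inner_smul_right, h1, h2, real_inner_comm (grad τ x) Y]
  ring

include hg hiso hτ hτ_mem hτ_grad

theorem finrank_tangentTo_add_two (hp : p ∈ unitNormalBundle m g) :
    Module.finrank ℝ (tangentTo (m := m) (unitNormalBundle m g) p) + 2 = Module.finrank ℝ E :=
  (tubeData hg hiso hτ hτ_mem hτ_grad hp).finrank_add_two

theorem norm_tubeMap (hp : p ∈ unitNormalBundle m g) : ‖tubeMap m g τ p‖ = 1 := by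
  have h := (tubeData hg hiso hτ hτ_mem hτ_grad hp).inner_F_F
  rw [tubeData_F, real_inner_self_eq_norm_sq] at h
  exact (pow_eq_one_iff_of_nonneg (norm_nonneg _) two_ne_zero).mp h

theorem mem_regularSet_iff {x : L} {w : E} (hp : (x, w) ∈ unitNormalBundle m g) :
    (x, w) ∈ regularSet m (unitNormalBundle m g) (tubeMap m g τ) ↔
      IsUnit (tubeP (m := m) g τ x w) := by
  have h := (tubeData hg hiso hτ hτ_mem hτ_grad hp).injective_dF_iff
  rw [tubeData_dF, tubeData_P] at h
  rw [LinearMap.isUnit_iff_ker_eq_bot, LinearMap.ker_eq_bot, ← h]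
  exact ⟨fun hr => hr.2, fun hr => ⟨hp, hr⟩⟩

theorem isUnitNormalAt_iff (hp : p ∈ regularSet m (unitNormalBundle m g) (tubeMap m g τ)) (ν : E) :
    IsUnitNormalAt m (unitNormalBundle m g) (tubeMap m g τ) p ν ↔
      ν = tubeNormal m g τ p ∨ ν = -tubeNormal m g τ p := by
  have h := (tubeData hg hiso hτ hτ_mem hτ_grad hp.1).unit_normal_iff
  rw [tubeData_dF, tubeData_F, tubeData_η] at h
  exact h hp.2 ν

theorem exists_tube_shape_operator
    (hp : p ∈ regularSet m (unitNormalBundle m g) (tubeMap m g τ))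
    (hdim : m + 2 < Module.finrank ℝ E) :
    ∃ A : Module.End ℝ (tangentTo (m := m) (unitNormalBundle m g) p),
      (∀ B, IsShapeOperatorAt (unitNormalBundle m g) (tubeMap m g τ) (tubeNormal m g τ) p B ↔
        B = A) ∧
      A.HasEigenvalue (Real.cot (τ p.1)) ∧
      A.eigenspace (Real.cot (τ p.1)) = verticalSpace (unitNormalBundle m g) p := by
  have h := (tubeData hg hiso hτ hτ_mem hτ_grad hp.1).exists_shape_operator
  rw [tubeData_dF, tubeData_dη] at h
  rw [Real.cot_eq_cos_div_sin]
  have hH : Module.finrank ℝ (TangentSpace (𝓡 m) p.1) = m := finrank_euclideanSpace_fin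
  exact h hp.2 (by rwa [hH])

end TubeDataOfImmersion

end SphereTube

end

/-! ### The theorem -/

theorem mainTheorem6 {n ℓ : ℕ} (hℓ : 2 ≤ ℓ) (hn : ℓ + 2 ≤ n)
    {L : Type*} [TopologicalSpace L] [T2Space L]
    [ChartedSpace (EuclideanSpace ℝ (Fin (n - ℓ))) L] [IsManifold (𝓡 (n - ℓ)) ∞ L]
    [Bundle.RiemannianBundle (fun x : L => TangentSpace (𝓡 (n - ℓ)) x)]
    [IsContMDiffRiemannianBundle (𝓡 (n - ℓ)) ∞ (EuclideanSpace ℝ (Fin (n - ℓ)))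
      (fun x : L => TangentSpace (𝓡 (n - ℓ)) x)]
    -- `g` is an isometric immersion into the unit sphere of dimension `n + 1`
    (g : L → Metric.sphere (0 : EuclideanSpace ℝ (Fin (n + 1 + 1))) 1)
    (hg : ContMDiff (𝓡 (n - ℓ)) (𝓡 (n + 1)) ∞ g)
    (hiso : ∀ (x : L) (Y Z : TangentSpace (𝓡 (n - ℓ)) x), ⟪dMap g x Y, dMap g x Z⟫ = ⟪Y, Z⟫)
    (τ : L → ℝ) (hτ : ContMDiff (𝓡 (n - ℓ)) 𝓘(ℝ, ℝ) ∞ τ)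
    (hτ_mem : ∀ x, τ x ∈ Set.Ioo 0 (Real.pi / 2))
    (hτ_grad : ∀ x, ‖grad (m := n - ℓ) τ x‖ < 1) :
    -- `Λ` has dimension `n` and `Ψ` is a smooth map from `Λ` to the unit sphere
    (∀ p ∈ unitNormalBundle (n - ℓ) g,
      Module.finrank ℝ (tangentTo (m := n - ℓ) (unitNormalBundle (n - ℓ) g) p) = n ∧
      ContMDiffAt ((𝓡 (n - ℓ)).prod 𝓘(ℝ, EuclideanSpace ℝ (Fin (n + 1 + 1))))
        𝓘(ℝ, EuclideanSpace ℝ (Fin (n + 1 + 1))) ∞ (tubeMap (n - ℓ) g τ) p ∧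
      ‖tubeMap (n - ℓ) g τ p‖ = 1) ∧
    -- (i) the regular points of `Ψ` are those at which the self-adjoint `P(x, w)` is nonsingular
    (∀ x w, (x, w) ∈ unitNormalBundle (n - ℓ) g →
      (tubeP (m := n - ℓ) g τ x w).IsSymmetric ∧
      ((x, w) ∈ regularSet (n - ℓ) (unitNormalBundle (n - ℓ) g) (tubeMap (n - ℓ) g τ) ↔
        IsUnit (tubeP (m := n - ℓ) g τ x w))) ∧
    -- (ii) `η` is the Gauss map of `Ψ`, which is unique up to sign
    (∀ p ∈ regularSet (n - ℓ) (unitNormalBundle (n - ℓ) g) (tubeMap (n - ℓ) g τ),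
      ContMDiffAt ((𝓡 (n - ℓ)).prod 𝓘(ℝ, EuclideanSpace ℝ (Fin (n + 1 + 1))))
        𝓘(ℝ, EuclideanSpace ℝ (Fin (n + 1 + 1))) ∞ (tubeNormal (n - ℓ) g τ) p ∧
      ∀ ν : EuclideanSpace ℝ (Fin (n + 1 + 1)),
        IsUnitNormalAt (n - ℓ) (unitNormalBundle (n - ℓ) g) (tubeMap (n - ℓ) g τ) p ν ↔
          ν = tubeNormal (n - ℓ) g τ p ∨ ν = -tubeNormal (n - ℓ) g τ p) ∧
    -- (iii) the shape operator has the eigenvalue `cot τ`, with the vertical space as eigenspace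
    (∀ p ∈ regularSet (n - ℓ) (unitNormalBundle (n - ℓ) g) (tubeMap (n - ℓ) g τ),
      ∃ A : Module.End ℝ (tangentTo (m := n - ℓ) (unitNormalBundle (n - ℓ) g) p),
        (∀ B, IsShapeOperatorAt (unitNormalBundle (n - ℓ) g) (tubeMap (n - ℓ) g τ)
          (tubeNormal (n - ℓ) g τ) p B ↔ B = A) ∧
        A.HasEigenvalue (Real.cot (τ p.1)) ∧
        A.eigenspace (Real.cot (τ p.1)) = verticalSpace (unitNormalBundle (n - ℓ) g) p) := by
  have hfact : Fact (Module.finrank ℝ (EuclideanSpace ℝ (Fin (n + 1 + 1))) = n + 1 + 1) :=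
    ⟨finrank_euclideanSpace_fin⟩
  -- All derivatives are taken in the ambient space, so g is composed with the inclusion of the
  -- sphere.
  have hgE : ContMDiff (𝓡 (n - ℓ)) 𝓘(ℝ, EuclideanSpace ℝ (Fin (n + 1 + 1))) ∞
      (fun y => (g y : EuclideanSpace ℝ (Fin (n + 1 + 1)))) :=
    (contMDiff_coe_sphere (n := n + 1) (E := EuclideanSpace ℝ (Fin (n + 1 + 1)))).comp hg
  have hpos : ∀ x, 0 < τ x := fun x => (hτ_mem x).1
  have hE : Module.finrank ℝ (EuclideanSpace ℝ (Fin (n + 1 + 1))) = n + 2 :=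
    finrank_euclideanSpace_fin
  refine ⟨fun p hp => ?_, fun x w hp => ?_, fun p hp => ?_, fun p hp => ?_⟩
  · refine ⟨?_, contMDiffAt_tubeMap hgE hiso hτ hpos hτ_grad hp,
      norm_tubeMap hgE hiso hτ hτ_mem hτ_grad hp⟩
    have h := finrank_tangentTo_add_two hgE hiso hτ hτ_mem hτ_grad hp
    rw [hE] at h
    exact Nat.add_right_cancel h
  · exact ⟨tubeP_isSymmetric hgE hiso hτ hp.1, mem_regularSet_iff hgE hiso hτ hτ_mem hτ_grad hp⟩
  · exact ⟨contMDiff_tubeNormal hgE hiso hτ hτ_grad p,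
      isUnitNormalAt_iff hgE hiso hτ hτ_mem hτ_grad hp⟩
  -- The inequality (n - ℓ) + 2 < n + 2 says that the fibres of Λ have positive dimension ℓ.
  · exact exists_tube_shape_operator hgE hiso hτ hτ_mem hτ_grad hp (by rw [hE]; omega)
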